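/- Let $m,s\ge 1$, let $p\in\mathbb F_2[x]$ be irreducible with $\deg p=m$, let $q=(q_1,\dots,q_s)\in(\mathbb F_2[x])^s$, write $I_s=\{1,\dots,s\}$, and let $\gamma_u\ge 0$ be given for all $u\subseteq I_s$. For points $x_0,\dots,x_{N-1}\in[0,1]^s$ put $$\Delta(t)=\tfrac1N\,\#\{0\le n<N: x_n\in[0,t_1)\times\cdots\times[0,t_s)\}-t_1\cdots t_s,$$ $$\mathcal L_{2,N,\gamma}=\Big(\sum_{\emptyset\ne u\subseteq I_s}\gamma_u\int_{[0,1]^{u}}|\Delta(t_u,1)|^2\,dt_u\Big)^{1/2},$$ where $(t_u,1)$ has the components $t_j$ for $j\in u$ and $1$ for $j\notin u$. The polynomial lattice point set $P_{2^m,s}(q,p)$ consists of the points $$x_n=\Big(v_m\Big(\frac{n(x)q_1(x)}{p(x)}\Big),\dots,v_m\Big(\frac{n(x)q_s(x)}{p(x)}\Big)\Big),\qquad 0\le n<2^m.$$ Here $k(x)=\sum_i\kappa_ix^i\in\mathbb F_2[x]$ for an integer $k=\sum_i\kappa_i2^i\ge0$ with binary digits $\kappa_i$, quotients are taken in $\mathbb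 F_2((x^{-1}))$, and $v_m(\sum_{l\ge w}t_lx^{-l})=\sum_{l=\max(1,w)}^m t_l2^{-l}$. With $\mathrm{tr}_m(k)=\sum_{i=0}^{m-1}\kappa_ix^i$, its dual polynomial lattice is $$D^*_{q,p}=\Big\{k\in\mathbb N_0^s:\ p \text{ divides } \sum_{j=1}^s\mathrm{tr}_m(k_j)\,q_j \text{ in } \mathbb F_2[x]\Big\}.$$ Let $\tilde P_{2^m,s}(q,p)$ be the Owen-scrambled point set. That is, the $k$-th binary digit $x_{j,k}$ of the $j$-th coordinate of each point (in the dyadic expansion without infinitely many consecutive ones) is replaced by $\pi_{j,x_{j,1},\dots,x_{j,k-1}}(x_{j,k})$, where the $\pi_{j,a}$ (for $j\in I_s$ and $a$ a finite, possibly empty, string of binary digits) are mutually independent random permutations of $\{0,1\}$, each uniformly distributed, and the same permutations are used for all points. Then $\mathcal L_{2,2^m,\gamma}^2(\tilde P_{2^m,s}(q,p))$ is integrable and $$\mathbb E\big[\mathcal L_{2,2^m,\gamma}^2(\tilde P_{2^m,s}(q,p))\big]=\sum_{\emptyset\ne v\subseteq I_s}\tilde\gamma_v\sum_{\substack{k_v\in\mathbb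 N^{|v|}\\(k_v,0)\in D^*_{q,p}}}\psi(k_v,0),\qquad \tilde\gamma_v=\sum_{v\subseteq u\subseteq I_s}\frac{\gamma_u}{3^{|u|}},$$ where all the inner sums converge. Here $\mathbb N=\{1,2,\dots\}$, the vector $(k_v,0)\in\mathbb N_0^s$ has the components of $k_v$ at the indices in $v$ and zeros elsewhere, $\psi(k_1,\dots,k_s)=\prod_{j=1}^s\psi(k_j)$, $\psi(0)=1$, and $\psi(k)=4^{-a_1}$ for an integer $k=2^{a_1-1}+\cdots+2^{a_r-1}$ with $a_1>\cdots>a_r>0$. -/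

import Mathlib

open MeasureTheory ProbabilityTheory Polynomial

noncomputable section

namespace PolyLat

/-! ### Weighted `L₂` discrepancy -/

/-- The vector `(t_u, 1)`: components outside `u` are replaced by one. -/
def extendOne {s : ℕ} (u : Finset (Fin s)) (t : u → ℝ) : Fin s → ℝ :=
  fun j => if h : j ∈ u then t ⟨j, h⟩ else 1

/-- The local discrepancy `Δ(t) = A_N([0,t), P) / N - t₁ ⋯ t_s` of the points
`x 0, …, x (N - 1)`; points are counted with multiplicity. -/
def localDiscrepancy {N s : ℕ} (x : Fin N → Fin s → ℝ) (t : Fin s → ℝ) : ℝ :=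
  (Nat.card {n : Fin N // ∀ j, x n j ∈ Set.Ico 0 (t j)} : ℝ) / N - ∏ j, t j

/-- The weighted `L₂` discrepancy with weights `γ`. -/
def weightedL2Discrepancy {N s : ℕ} (γ : Finset (Fin s) → ℝ) (x : Fin N → Fin s → ℝ) : ℝ :=
  Real.sqrt (∑ u : Finset (Fin s) with u.Nonempty,
    γ u * ∫ t in Set.Icc (0 : u → ℝ) 1, |localDiscrepancy x (extendOne u t)| ^ 2)

/-! ### Polynomial lattice point sets -/

/-- The embedding of `𝔽₂[x]` into the field `𝔽₂((x⁻¹))` of formal Laurent series in `x⁻¹`.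
An element of the latter is a Laurent series whose coefficient at `l` belongs to `x^(-l)`,
so that `x` is the series with the single coefficient `1` at `-1`. -/
def toLaurent (f : (ZMod 2)[X]) : LaurentSeries (ZMod 2) :=
  Polynomial.aeval (HahnSeries.single (-1 : ℤ) (1 : ZMod 2) : LaurentSeries (ZMod 2)) f

/-- `v_m (∑ t_l x^(-l)) = ∑_{1 ≤ l ≤ m} t_l 2^(-l)`. -/
def truncEval (m : ℕ) (L : LaurentSeries (ZMod 2)) : ℝ :=
  ∑ l ∈ Finset.Icc 1 m, ((L.coeff (l : ℤ)).val : ℝ) / 2 ^ l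

/-- `tr_m(k) = k₀ + k₁ x + ⋯ + k_{m-1} x^(m-1)`, where `k₀, k₁, …` are the binary digits of `k`. -/
def truncPoly (m k : ℕ) : (ZMod 2)[X] :=
  ∑ i ∈ Finset.range m, if k.testBit i then X ^ i else 0

/-- The polynomial `k(x)` over `𝔽₂` whose coefficients are the binary digits of `k`
(a number `k` has `k.size` binary digits). -/
def natPoly (k : ℕ) : (ZMod 2)[X] := truncPoly k.size k

/-- The polynomial lattice point set `P_{2^m,s}(q,p)`: its `n`-th point has the components
`v_m (n(x) q_j(x) / p(x))`. -/
def polyLatticePoint {s : ℕ} (m : ℕ) (p : (ZMod 2)[X]) (q : Fin s → (ZMod 2)[X]) :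
    Fin (2 ^ m) → Fin s → ℝ :=
  fun n j => truncEval m (toLaurent (natPoly n * q j) / toLaurent p)

/-- The dual polynomial lattice `{k : tr_m(k) · q ≡ 0 (mod p)}`. -/
def dualLattice {s : ℕ} (m : ℕ) (p : (ZMod 2)[X]) (q : Fin s → (ZMod 2)[X]) :
    Set (Fin s → ℕ) :=
  {k | p ∣ ∑ j, truncPoly m (k j) * q j}

/-! ### Owen's scrambling -/

/-- The scrambling of one coordinate: the digit after the prefix `x₁, …, x_k` of the dyadic
expansion of `x` is permuted by `σ [x₁, …, x_k]`. (`Real.digits x 2 i` is the binary digit of `x`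
belonging to `2^(-(i+1))`, in the expansion without infinitely many consecutive ones.) -/
def scramble (σ : List (Fin 2) → Equiv.Perm (Fin 2)) (x : ℝ) : ℝ :=
  Real.ofDigits fun k : ℕ =>
    σ (List.ofFn fun i : Fin k => Real.digits x 2 i) (Real.digits x 2 k)

/-- The scrambled point set; coordinate `j` of every point is scrambled by the same family
`σ j` of permutations. -/
def scramblePoints {N s : ℕ} (σ : Fin s → List (Fin 2) → Equiv.Perm (Fin 2))
    (x : Fin N → Fin s → ℝ) : Fin N → Fin s → ℝ :=
  fun n j => scramble (σ j) (x n j)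

/-- The random permutations used by Owen's scrambling in base two: one for each coordinate and
each finite digit prefix, mutually independent, each uniform on the two permutations of
`{0, 1}`. -/
structure IsOwenScrambling {Ω : Type*} [MeasurableSpace Ω] {s : ℕ} (P : Measure Ω)
    (π : Fin s → List (Fin 2) → Ω → Equiv.Perm (Fin 2)) : Prop where
  measurable : ∀ j a, Measurable[_, ⊤] (π j a)
  indep : iIndepFun (β := fun _ => Equiv.Perm (Fin 2)) (m := fun _ => ⊤)
    (fun i : Fin s × List (Fin 2) => π i.1 i.2) P
  uniform : ∀ j a τ, P {ω | π j a ω = τ} = 1 / 2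

/-! ### The dual lattice sum -/

/-- `γ̃_v = ∑_{v ⊆ u} γ_u / 3^|u|`. -/
def gammaTilde {s : ℕ} (γ : Finset (Fin s) → ℝ) (v : Finset (Fin s)) : ℝ :=
  ∑ u : Finset (Fin s) with v ⊆ u, γ u / 3 ^ u.card

/-- The vector `(k_v, 0)`: components outside `v` are replaced by zero. -/
def extendZero {s : ℕ} (v : Finset (Fin s)) (k : v → ℕ+) : Fin s → ℕ :=
  fun j => if h : j ∈ v then (k ⟨j, h⟩ : ℕ) else 0

/-- `ψ(0) = 1`, and `ψ(k) = 4^(-a₁)` for `k = 2^(a₁-1) + ⋯ + 2^(a_r-1)` with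
`a₁ > ⋯ > a_r > 0`, that is, `a₁ = ⌊log₂ k⌋ + 1`. -/
def psi (k : ℕ) : ℝ := if k = 0 then 1 else 1 / 4 ^ (Nat.log 2 k + 1)

/-- `ψ(k) = ∏_j ψ(k_j)` for vectors. -/
def psiVec {s : ℕ} (k : Fin s → ℕ) : ℝ := ∏ j, psi (k j)

end PolyLat

end

/-! For points in `[0,1)^s`, Warnock's formula writes the integral of the squared local discrepancy
over `[0,1]^u` as a mean over pairs of points of the products of `1 - max`, minus twice a mean over
single points of the products of `(1 - x²)/2`, plus `3^(-|u|)`. Scrambled coordinates are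
independent and each has second moment `1/3`, so the last two terms have expectation `-2·3^(-|u|) +
3^(-|u|) = -3^(-|u|)`.

For a pair, the expectation of `1 - max` in one coordinate depends only on the first digit at which
the original numbers differ. It is one third of a Walsh series with coefficients `psi`, evaluated at
their digitwise difference (`integral_one_sub_max`). The expected integral is therefore `3^(-|u|)`
times the pair mean of a product of Walsh series, minus one. Splitting off the constant term of each
factor expands the product over `v ⊆ u`; the empty `v` cancels the minus one.

Finally, the pair mean of a product of Walsh functions is the square of a normalized character sum
over the lattice, hence the indicator of the dual lattice (`mean_prod_walsh_lattice`). Exchanging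
the sums over `u` and `v` collects the weights `gammaTilde`. -/

noncomputable section

namespace PolyLat

/-! ### Walsh functions -/

/-- The nontrivial real character of `𝔽₂`. -/
def sign (c : ZMod 2) : ℝ := if c = 0 then 1 else -1

@[simp] lemma sign_zero : sign 0 = 1 := by simp [sign]

@[simp] lemma sign_one : sign 1 = -1 := by simp [sign]

lemma sign_add (a b : ZMod 2) : sign (a + b) = sign a * sign b := by
  have h : ∀ a b : ZMod 2, (a + b = 0 ↔ (a = 0 ↔ b = 0)) := by decide
  unfold sign
  by_cases ha : a = 0 <;> by_cases hb : b = 0 <;> simp [h, ha, hb]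

lemma abs_sign (a : ZMod 2) : |sign a| = 1 := by
  unfold sign; split_ifs <;> simp

lemma sign_sum {ι : Type*} (s : Finset ι) (f : ι → ZMod 2) :
    sign (∑ i ∈ s, f i) = ∏ i ∈ s, sign (f i) := by
  classical
  induction s using Finset.induction_on with
  | empty => simp
  | insert a s ha ih => rw [Finset.sum_insert ha, Finset.prod_insert ha, sign_add, ih]

/-- The `k`-th Walsh function of a sequence of binary digits. -/
def walsh (k : ℕ) (b : ℕ → ZMod 2) : ℝ :=
  ∏ i ∈ Finset.range k, if k.testBit i then sign (b i) else 1

/-- The range in `walsh` is only a crude bound for the number of digits of `k`. Zero digits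
contribute the factor one, so any sufficient range may be used. -/
lemma walsh_eq_prod_range {k M : ℕ} (hk : k < 2 ^ M) (b : ℕ → ZMod 2) :
    walsh k b = ∏ i ∈ Finset.range M, if k.testBit i then sign (b i) else 1 := by
  have key : ∀ M' N' : ℕ, k < 2 ^ M' → M' ≤ N' →
      ∏ i ∈ Finset.range M', (if k.testBit i then sign (b i) else 1) =
        ∏ i ∈ Finset.range N', if k.testBit i then sign (b i) else 1 := by
    intro M' N' h1 h2
    refine Finset.prod_subset (by simpa using h2) fun i _ hi => ?_
    rw [Nat.testBit_lt_two_pow (h1.trans_le (Nat.pow_le_pow_right (by norm_num)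
      (by simpa using hi)))]
    simp
  rcases le_total k M with h | h
  · exact key k M Nat.lt_two_pow_self h
  · exact (key M k hk h).symm

lemma walsh_zero (b : ℕ → ZMod 2) : walsh 0 b = 1 := by simp [walsh]

lemma walsh_two_mul (k : ℕ) (b : ℕ → ZMod 2) :
    walsh (2 * k) b = walsh k fun i => b (i + 1) := by
  rw [walsh_eq_prod_range (M := k + 1) (by have := @Nat.lt_two_pow_self k; omega),
    Finset.prod_range_succ', walsh]
  simp [Nat.testBit_succ]

lemma walsh_two_mul_add_one (k : ℕ) (b : ℕ → ZMod 2) :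
    walsh (2 * k + 1) b = sign (b 0) * walsh k fun i => b (i + 1) := by
  rw [walsh_eq_prod_range (M := k + 1) (by have := @Nat.lt_two_pow_self k; omega),
    Finset.prod_range_succ', walsh, mul_comm]
  simp [Nat.testBit_succ, show (2 * k + 1) / 2 = k by omega]

lemma abs_walsh (k : ℕ) (b : ℕ → ZMod 2) : |walsh k b| = 1 := by
  rw [walsh, Finset.abs_prod]
  refine Finset.prod_eq_one fun i _ => ?_
  split_ifs <;> simp [abs_sign]

/-- On digit sequences of length `m`, a Walsh function depends on the first `m` digits of `k`. -/
lemma walsh_eq_sign_sum {m : ℕ} (k : ℕ) (b : ℕ → ZMod 2) (hb : ∀ i, m ≤ i → b i = 0) :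
    walsh k b = sign (∑ i ∈ Finset.range m, if k.testBit i then b i else 0) := by
  rw [walsh_eq_prod_range (M := max k m) (Nat.lt_two_pow_self.trans_le
    (Nat.pow_le_pow_right (by norm_num) (le_max_left _ _))), sign_sum]
  symm
  refine (Finset.prod_congr rfl fun i _ => ?_).trans
    (Finset.prod_subset (by simp) fun i _ hi => ?_)
  · split_ifs <;> simp
  · rw [hb i (by simpa using hi)]; simp

/-! ### The function `psi` and its Walsh series -/

lemma psi_zero : psi 0 = 1 := by simp [psi]

lemma psi_one : psi 1 = 1 / 4 := by simp [psi]

lemma psi_nonneg (k : ℕ) : 0 ≤ psi k := by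
  unfold psi; split_ifs <;> positivity

lemma psi_two_mul {k : ℕ} (hk : k ≠ 0) : psi (2 * k) = psi k / 4 := by
  have : Nat.log 2 (2 * k) = Nat.log 2 k + 1 := by
    rw [mul_comm, Nat.log_mul_base (by norm_num) hk]
  simp only [psi, hk, this, mul_eq_zero, OfNat.ofNat_ne_zero, or_self, if_false]
  rw [pow_succ _ (Nat.log 2 k + 1)]
  field_simp

lemma psi_two_mul_add_one {k : ℕ} (hk : k ≠ 0) : psi (2 * k + 1) = psi k / 4 := by
  have : Nat.log 2 (2 * k + 1) = Nat.log 2 k + 1 := by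
    rw [Nat.log_of_one_lt_of_le (by norm_num) (by omega), show (2 * k + 1) / 2 = k by omega]
  simp only [psi, hk, this, if_false, Nat.add_eq_zero_iff, one_ne_zero, and_false]
  rw [pow_succ _ (Nat.log 2 k + 1)]
  field_simp

lemma summable_psi : Summable psi := by
  have h := (Real.summable_one_div_nat_pow (p := 2)).2 (by norm_num)
  -- The majorant is `1 / k²`, which is zero at `k = 0` by the convention for division; the extra
  -- term there covers `psi 0 = 1`.
  refine (h.add (summable_of_ne_finset_zero (s := {0})
    (f := fun k : ℕ => if k = 0 then (1 : ℝ) else 0) (by simp +contextual))).of_nonneg_of_le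
    psi_nonneg fun k => ?_
  rcases eq_or_ne k 0 with rfl | hk
  · simp [psi]
  · simp only [psi, hk, if_false, add_zero]
    have h1 : k < 2 ^ (Nat.log 2 k + 1) := Nat.lt_pow_succ_log_self (by norm_num) k
    have h2 : k ^ 2 ≤ 4 ^ (Nat.log 2 k + 1) := by
      calc k ^ 2 ≤ (2 ^ (Nat.log 2 k + 1)) ^ 2 := Nat.pow_le_pow_left h1.le 2
        _ = 4 ^ (Nat.log 2 k + 1) := by rw [← pow_mul, mul_comm, pow_mul]; norm_num
    have h3 : (0 : ℝ) < (k : ℝ) ^ 2 := by positivity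
    exact one_div_le_one_div_of_le h3 (by exact_mod_cast h2)

lemma summable_psi_mul_walsh (b : ℕ → ZMod 2) : Summable fun k => psi k * walsh k b := by
  refine summable_psi.of_norm_bounded fun k => ?_
  rw [Real.norm_eq_abs, abs_mul, abs_walsh, mul_one, abs_of_nonneg (psi_nonneg k)]

/-- The sum of the Walsh series with the coefficients `psi`. -/
def psiSeries (b : ℕ → ZMod 2) : ℝ := ∑' k, psi k * walsh k b

lemma hasSum_of_eq {κ : Type*} {f g : κ → ℝ} {a : ℝ} (e : ∀ k, g k = f k) (h : HasSum f a) :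
    HasSum g a := by
  rwa [show g = f from funext e]

/-- Splitting into even and odd `k` removes the lowest binary digit, which shifts `b` and divides
`psi` by four. The indices 0 and 1 do not follow this rule and give the explicit terms. -/
lemma psiSeries_eq (b : ℕ → ZMod 2) :
    psiSeries b = 1 + sign (b 0) / 4 +
      (1 + sign (b 0)) / 4 * (psiSeries (fun i => b (i + 1)) - 1) := by
  set b' : ℕ → ZMod 2 := fun i => b (i + 1)
  have h := (summable_psi_mul_walsh b').hasSum
  have h0 : HasSum (fun k => (if k = 0 then 0 else psi k * walsh k b')) (psiSeries b' - 1) := by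
    have := h.sub (hasSum_ite_eq 0 (1 : ℝ))
    refine hasSum_of_eq (fun k => ?_) this
    rcases eq_or_ne k 0 with rfl | hk
    · simp [psi_zero, walsh_zero]
    · simp [hk]
  have h1 : HasSum (fun k => psi (2 * k) * walsh (2 * k) b) (1 + (psiSeries b' - 1) / 4) := by
    refine hasSum_of_eq (fun k => ?_) ((hasSum_ite_eq 0 (1 : ℝ)).add (h0.div_const 4))
    rcases eq_or_ne k 0 with rfl | hk
    · simp [psi_zero, walsh_zero]
    · simp only [hk, if_false, psi_two_mul hk, walsh_two_mul, b']; ring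
  have h2 : HasSum (fun k => psi (2 * k + 1) * walsh (2 * k + 1) b)
      (sign (b 0) / 4 + sign (b 0) * ((psiSeries b' - 1) / 4)) := by
    refine hasSum_of_eq (fun k => ?_)
      ((hasSum_ite_eq 0 (sign (b 0) / 4)).add ((h0.div_const 4).mul_left _))
    rcases eq_or_ne k 0 with rfl | hk
    · have := walsh_two_mul_add_one 0 b
      simp only [mul_zero, zero_add, walsh_zero, mul_one] at this
      simp [psi_one, this]; ring
    · simp only [hk, if_false, psi_two_mul_add_one hk, walsh_two_mul_add_one, b']; ring
  rw [psiSeries, (HasSum.even_add_odd (f := fun k => psi k * walsh k b) h1 h2).tsum_eq]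
  ring

lemma psiSeries_zero : psiSeries 0 = 3 / 2 := by
  have := psiSeries_eq 0
  have h : (fun i => (0 : ℕ → ZMod 2) (i + 1)) = 0 := rfl
  rw [h] at this
  simp only [Pi.zero_apply, sign_zero] at this
  linarith

/-- In the recursion `psiSeries_eq`, a nonzero first digit makes the factor `1 + sign (b 0)` vanish,
so all later digits become irrelevant. A zero first digit gives the affine map `S ↦ 3/4 + S/2`, with
fixed point `3/2`. -/
lemma psiSeries_of_first_ne {b : ℕ → ZMod 2} {i : ℕ} (hi : b i ≠ 0) (h : ∀ l < i, b l = 0) :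
    psiSeries b = 3 * (1 / 2 - (1 / 2) ^ (i + 2)) := by
  induction i generalizing b with
  | zero =>
    rw [psiSeries_eq, sign, if_neg hi]
    norm_num
  | succ i ih =>
    rw [psiSeries_eq, h 0 (by omega), sign_zero,
      ih (b := fun i => b (i + 1)) hi fun l hl => h _ (by omega)]
    ring

lemma hasSum_pnat_psi_mul_walsh (b : ℕ → ZMod 2) :
    HasSum (fun k : ℕ+ => psi k * walsh k b) (psiSeries b - 1) := by
  have h := (hasSum_nat_add_iff' 1).2 (summable_psi_mul_walsh b).hasSum
  simp only [Finset.range_one, Finset.sum_singleton, psi_zero, walsh_zero, mul_one] at h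
  refine (Equiv.pnatEquivNat.symm.hasSum_iff (f := fun k : ℕ+ => psi k * walsh k b)).1 ?_
  simpa [Function.comp_def, psiSeries] using h

/-! ### Finite products of series -/

/-- Absolute summability is carried through the induction because the product of two series needs
it. -/
lemma hasSum_pi_fin_prod {κ : Type*} {n : ℕ} (f : Fin n → κ → ℝ) (a : Fin n → ℝ)
    (hf : ∀ i, Summable fun k => ‖f i k‖) (ha : ∀ i, HasSum (f i) (a i)) :
    (Summable fun k : Fin n → κ => ‖∏ i, f i (k i)‖) ∧
      HasSum (fun k : Fin n → κ => ∏ i, f i (k i)) (∏ i, a i) := by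
  induction n with
  | zero =>
    simp only [Finset.univ_eq_empty, Finset.prod_empty, norm_one]
    exact ⟨(hasSum_fintype _).summable, by simp⟩
  | succ n ih =>
    obtain ⟨h1, h2⟩ := ih (fun i => f i.succ) (fun i => a i.succ) (fun i => hf _) fun i => ha _
    let E : κ × (Fin n → κ) ≃ (Fin (n + 1) → κ) := Fin.consEquiv (n := n) (fun _ => κ)
    have hE : ∀ z, ∏ i, f i (E z i) = f 0 z.1 * ∏ i, f (Fin.succ i) (z.2 i) := fun z => by
      simp [E, Fin.consEquiv, Fin.prod_univ_succ]
    constructor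
    · refine E.summable_iff.1 ?_
      have := Summable.mul_norm (f := f 0) (g := fun k : Fin n → κ => ∏ i : Fin n, f i.succ (k i)) (hf 0) h1
      simpa only [Function.comp_def, hE] using this
    · refine E.hasSum_iff.1 ?_
      rw [Fin.prod_univ_succ]
      have h3 := summable_mul_of_summable_norm (f := f 0)
        (g := fun k : Fin n → κ => ∏ i : Fin n, f i.succ (k i)) (hf 0) h1
      have := (ha 0).mul h2 h3
      simpa only [Function.comp_def, hE] using this

lemma hasSum_pi_prod {ι κ : Type*} [Fintype ι] (f : ι → κ → ℝ) (a : ι → ℝ)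
    (hf : ∀ i, Summable fun k => ‖f i k‖) (ha : ∀ i, HasSum (f i) (a i)) :
    HasSum (fun k : ι → κ => ∏ i, f i (k i)) (∏ i, a i) := by
  let e := (Fintype.equivFin ι).symm
  have h := (hasSum_pi_fin_prod (fun i => f (e i)) (fun i => a (e i)) (fun i => hf _)
    fun i => ha _).2
  rw [e.prod_comp a] at h
  let E : (ι → κ) ≃ (Fin (Fintype.card ι) → κ) := e.symm.arrowCongr (Equiv.refl κ)
  refine hasSum_of_eq (fun k => ?_) (E.hasSum_iff.2 h)
  simpa [E] using (e.prod_comp fun i => f i (k i)).symm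

/-! ### Sequences of binary digits -/

lemma summable_half_pow_succ : Summable fun k : ℕ => (1 / 2 : ℝ) ^ (k + 1) :=
  (summable_nat_add_iff 1).2 (summable_geometric_of_lt_one (by norm_num) (by norm_num))

lemma hasSum_half_pow_succ : HasSum (fun k : ℕ => (1 / 2 : ℝ) ^ (k + 1)) 1 := by
  have := (hasSum_geometric_of_lt_one (r := (1 / 2 : ℝ)) (by norm_num) (by norm_num)).mul_left
    (1 / 2)
  norm_num at this
  simpa [pow_succ, mul_comm] using this

lemma hasSum_quarter_pow_succ : HasSum (fun k : ℕ => (1 / 4 : ℝ) ^ (k + 1)) (1 / 3) := by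
  have := (hasSum_geometric_of_lt_one (r := (1 / 4 : ℝ)) (by norm_num) (by norm_num)).mul_left
    (1 / 4)
  norm_num at this
  simpa [pow_succ, mul_comm] using this

lemma hasSum_ofDigits (d : ℕ → Fin 2) :
    HasSum (fun k => (1 / 2 : ℝ) ^ (k + 1) * ((d k : ℕ) : ℝ)) (Real.ofDigits d) := by
  refine hasSum_of_eq (fun k => ?_) (Real.summable_ofDigitsTerm (digits := d)).hasSum
  simp [Real.ofDigitsTerm, mul_comm]

lemma fin_two_cast_le_one (c : Fin 2) : ((c : ℕ) : ℝ) ≤ 1 := by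
  exact_mod_cast Nat.lt_succ_iff.1 c.2

lemma fin_two_cast_mul_self (c : Fin 2) : ((c : ℕ) : ℝ) * ((c : ℕ) : ℝ) = ((c : ℕ) : ℝ) := by
  fin_cases c <;> simp

/-- The tail after position `i` is worth at most one unit of digit `i`. Equality can occur, as for
`0111…` and `1000…`. -/
lemma ofDigits_le_ofDigits {a b : ℕ → Fin 2} {i : ℕ} (hab : ∀ l < i, a l = b l) (ha : a i = 0)
    (hb : b i = 1) : Real.ofDigits a ≤ Real.ofDigits b := by
  rw [Real.ofDigits_eq_sum_add_ofDigits a (i + 1), Real.ofDigits_eq_sum_add_ofDigits b (i + 1),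
    Finset.sum_range_succ, Finset.sum_range_succ]
  have h : ∑ l ∈ Finset.range i, Real.ofDigitsTerm a l =
      ∑ l ∈ Finset.range i, Real.ofDigitsTerm b l :=
    Finset.sum_congr rfl fun l hl => by simp [Real.ofDigitsTerm, hab l (Finset.mem_range.1 hl)]
  have h1 := Real.ofDigits_le_one fun l => a (l + (i + 1))
  have h2 := Real.ofDigits_nonneg fun l => b (l + (i + 1))
  have h3 : (0 : ℝ) < (((2 : ℕ) : ℝ) ^ (i + 1))⁻¹ := by positivity
  have h4 : Real.ofDigitsTerm a i = 0 := by simp [Real.ofDigitsTerm, ha]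
  have h5 : Real.ofDigitsTerm b i = (((2 : ℕ) : ℝ) ^ (i + 1))⁻¹ := by
    simp [Real.ofDigitsTerm, hb]
  rw [h, h4, h5]
  nlinarith

lemma eq_one_of_ofDigits_eq_one {d : ℕ → Fin 2} (h : Real.ofDigits d = 1) (k : ℕ) : d k = 1 := by
  have h1 := hasSum_half_pow_succ.sub (hasSum_ofDigits d)
  rw [h, sub_self, hasSum_zero_iff_of_nonneg] at h1
  · have := congrFun h1 k
    have h2 : (1 / 2 : ℝ) ^ (k + 1) ≠ 0 := by positivity
    rw [Pi.zero_apply] at this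
    have h3 : ((d k : ℕ) : ℝ) = 1 := by
      apply mul_left_cancel₀ h2; linarith
    ext
    exact_mod_cast h3
  · intro k
    have h2 : (0 : ℝ) < (1 / 2 : ℝ) ^ (k + 1) := by positivity
    have := fin_two_cast_le_one (d k)
    nlinarith

section Probability

variable {Ω : Type*} [MeasurableSpace Ω] {P : Measure Ω}

lemma measurable_ofDigits {D : ℕ → Ω → Fin 2} (hD : ∀ k, Measurable (D k)) :
    Measurable fun ω => Real.ofDigits fun k => D k ω :=
  (Real.continuous_ofDigits (b := 2)).measurable.comp (measurable_pi_lambda _ hD)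

lemma measurable_fin_cast {D : Ω → Fin 2} (hD : Measurable D) :
    Measurable fun ω => ((D ω : ℕ) : ℝ) :=
  (measurable_of_finite fun c : Fin 2 => ((c : ℕ) : ℝ)).comp hD

lemma integrable_of_abs_le_one [IsProbabilityMeasure P] {Z : Ω → ℝ} (hZ : Measurable Z)
    (h : ∀ ω, |Z ω| ≤ 1) : Integrable Z P :=
  Integrable.of_bound hZ.aestronglyMeasurable 1 (ae_of_all _ h)

/-- Reduces moments of scrambled numbers to moments of digits: `Z` will be one, a single digit, or
the number itself. -/
lemma hasSum_integral_mul_ofDigits [IsProbabilityMeasure P] {D : ℕ → Ω → Fin 2}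
    (hD : ∀ k, Measurable (D k)) {Z : Ω → ℝ} (hZ : Measurable Z) (h : ∀ ω, |Z ω| ≤ 1) :
    HasSum (fun k => (1 / 2 : ℝ) ^ (k + 1) * ∫ ω, Z ω * ((D k ω : ℕ) : ℝ) ∂P)
      (∫ ω, Z ω * Real.ofDigits (fun k => D k ω) ∂P) := by
  have hb : ∀ k ω, |Z ω * ((D k ω : ℕ) : ℝ)| ≤ 1 := fun k ω => by
    rw [abs_mul, Nat.abs_cast]
    exact mul_le_one₀ (h ω) (Nat.cast_nonneg _) (fin_two_cast_le_one _)
  have hi : ∀ k, Integrable (fun ω => Z ω * ((D k ω : ℕ) : ℝ)) P := fun k =>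
    integrable_of_abs_le_one (hZ.mul (measurable_fin_cast (hD k))) (hb k)
  have key := hasSum_integral_of_summable_integral_norm (μ := P)
    (F := fun k ω => (1 / 2 : ℝ) ^ (k + 1) * (Z ω * ((D k ω : ℕ) : ℝ)))
    (fun k => (hi k).const_mul _) ?_
  · simp only [integral_const_mul] at key
    have e : ∫ ω, Z ω * Real.ofDigits (fun k => D k ω) ∂P =
        ∫ ω, ∑' k, (1 / 2 : ℝ) ^ (k + 1) * (Z ω * ((D k ω : ℕ) : ℝ)) ∂P := by
      refine integral_congr_ae (ae_of_all _ fun ω => ?_)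
      dsimp only
      rw [← ((hasSum_ofDigits fun k => D k ω).mul_left (Z ω)).tsum_eq]
      exact tsum_congr fun k => by ring
    rwa [e]
  · refine summable_half_pow_succ.of_nonneg_of_le
      (fun k => integral_nonneg fun ω => norm_nonneg _) fun k => ?_
    have h0 : (0 : ℝ) < (1 / 2 : ℝ) ^ (k + 1) := by positivity
    calc ∫ ω, ‖(1 / 2 : ℝ) ^ (k + 1) * (Z ω * ((D k ω : ℕ) : ℝ))‖ ∂P
        ≤ ∫ _, (1 / 2 : ℝ) ^ (k + 1) ∂P := by
          refine integral_mono ((hi k).const_mul _).norm (integrable_const _) fun ω => ?_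
          simp only [norm_mul, Real.norm_eq_abs, abs_of_pos h0]
          rw [← abs_mul]
          exact mul_le_of_le_one_right h0.le (hb k ω)
      _ = _ := by simp

/-! ### Uniform independent permutations -/

instance : MeasurableSpace (Equiv.Perm (Fin 2)) := ⊤

instance : DiscreteMeasurableSpace (Equiv.Perm (Fin 2)) := ⟨fun _ => trivial⟩

/-- The permutations used by Owen's scrambling in one coordinate. -/
structure IsOwenTree (P : Measure Ω) (σ : List (Fin 2) → Ω → Equiv.Perm (Fin 2)) : Prop where
  measurable : ∀ a, Measurable (σ a)
  indep : iIndepFun σ P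
  uniform : ∀ a τ, P {ω | σ a ω = τ} = 1 / 2

/-- The first `k` terms of a digit sequence. -/
def digitPrefix (x : ℕ → Fin 2) (k : ℕ) : List (Fin 2) := List.ofFn fun i : Fin k => x i

/-- Digits at different positions are thus governed by different, hence independent, permutations,
even when they belong to different points. -/
lemma digitPrefix_ne {k l : ℕ} (h : k ≠ l) (x y : ℕ → Fin 2) :
    digitPrefix x k ≠ digitPrefix y l := fun e => h (by
  simpa [digitPrefix] using congrArg List.length e)

lemma digitPrefix_congr {k : ℕ} {x y : ℕ → Fin 2} (h : ∀ i < k, x i = y i) :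
    digitPrefix x k = digitPrefix y k := by
  unfold digitPrefix
  congr 1
  ext i
  rw [h i i.2]

/-- The digitwise difference of two sequences of binary digits. -/
def digitDifference (x y : ℕ → Fin 2) (k : ℕ) : ZMod 2 := if x k = y k then 0 else 1

/-- The digits of the scrambled number with the digits `x`. -/
def scrambledDigit (σ : List (Fin 2) → Equiv.Perm (Fin 2)) (x : ℕ → Fin 2) (k : ℕ) : Fin 2 :=
  σ (digitPrefix x k) (x k)

lemma scramble_eq (σ : List (Fin 2) → Equiv.Perm (Fin 2)) (x : ℝ) :
    scramble σ x = Real.ofDigits (scrambledDigit σ (Real.digits x 2)) := rfl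

lemma scramble_nonneg (σ : List (Fin 2) → Equiv.Perm (Fin 2)) (x : ℝ) : 0 ≤ scramble σ x :=
  Real.ofDigits_nonneg _

lemma scramble_le_one (σ : List (Fin 2) → Equiv.Perm (Fin 2)) (x : ℝ) : scramble σ x ≤ 1 :=
  Real.ofDigits_le_one _

lemma measurable_perm_apply (c : Fin 2) : Measurable fun τ : Equiv.Perm (Fin 2) => τ c :=
  measurable_of_finite _

lemma measurable_scramble (x : ℝ) :
    Measurable fun σ : List (Fin 2) → Equiv.Perm (Fin 2) => scramble σ x := by
  simp only [scramble_eq]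
  exact measurable_ofDigits fun k => (measurable_perm_apply _).comp (measurable_pi_apply _)

lemma exists_perm_apply_eq_iff (c d : Fin 2) :
    ∃ τ : Equiv.Perm (Fin 2), ∀ ρ : Equiv.Perm (Fin 2), ρ c = d ↔ ρ = τ := by
  revert c d; decide

namespace IsOwenTree

variable {σ : List (Fin 2) → Ω → Equiv.Perm (Fin 2)} (hσ : IsOwenTree P σ)
include hσ

lemma measure_apply_eq (a : List (Fin 2)) (c d : Fin 2) : P {ω | σ a ω c = d} = 1 / 2 := by
  obtain ⟨τ, hτ⟩ := exists_perm_apply_eq_iff c d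
  simp only [hτ, hσ.uniform]

lemma measurable_digit (a : List (Fin 2)) (c : Fin 2) : Measurable fun ω => σ a ω c :=
  (measurable_perm_apply c).comp (hσ.measurable a)

lemma integral_digit (a : List (Fin 2)) (c : Fin 2) :
    ∫ ω, ((σ a ω c : ℕ) : ℝ) ∂P = 1 / 2 := by
  have : (fun ω => ((σ a ω c : ℕ) : ℝ)) = Set.indicator {ω | σ a ω c = 1} 1 := by
    ext ω
    by_cases h : σ a ω c = 1
    · simp [h]
    · have h0 : σ a ω c = 0 := by omega
      simp [h0]
  have hs : MeasurableSet {ω | σ a ω c = 1} :=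
    (hσ.measurable_digit a c) (measurableSet_singleton 1)
  rw [this, integral_indicator_one hs, measureReal_def, hσ.measure_apply_eq]
  simp

lemma integral_digit_mul_digit {a b : List (Fin 2)} (hab : a ≠ b) (c d : Fin 2) :
    ∫ ω, ((σ a ω c : ℕ) : ℝ) * ((σ b ω d : ℕ) : ℝ) ∂P = 1 / 4 := by
  have h := (hσ.indep.indepFun hab).comp (measurable_fin_cast (measurable_perm_apply c))
    (measurable_fin_cast (measurable_perm_apply d))
  have h1 := h.integral_fun_mul_eq_mul_integral
    (measurable_fin_cast (hσ.measurable_digit a c)).aestronglyMeasurable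
    (measurable_fin_cast (hσ.measurable_digit b d)).aestronglyMeasurable
  simp only [Function.comp_def, hσ.integral_digit] at h1
  rw [h1]; norm_num

/-- The value one forces every digit to be one, and the first `n` digits are independent, which has
probability `2^(-n)`. This null set must be excluded because Warnock's formula is used for points in
`[0,1)^s`. -/
lemma ae_ofDigits_ne_one (x : ℕ → Fin 2) :
    ∀ᵐ ω ∂P, Real.ofDigits (scrambledDigit (fun a => σ a ω) x) ≠ 1 := by
  have hind : iIndepFun (fun k => σ (digitPrefix x k)) P :=
    hσ.indep.precomp (g := digitPrefix x) fun k l h => by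
      by_contra hkl; exact digitPrefix_ne hkl x x h
  have hle : ∀ n : ℕ, P {ω | Real.ofDigits (scrambledDigit (fun a => σ a ω) x) = 1} ≤
      (1 / 2) ^ n := fun n => by
    have := hind.measure_inter_preimage_eq_mul (Finset.range n)
      (sets := fun k => {τ : Equiv.Perm (Fin 2) | τ (x k) = 1}) fun _ _ => trivial
    simp only [Set.preimage_ofPred_eq, hσ.measure_apply_eq, Finset.prod_const,
      Finset.card_range] at this
    rw [← this]
    refine measure_mono fun ω hω => ?_
    simp only [Set.mem_iInter]
    exact fun k _ => eq_one_of_ofDigits_eq_one hω k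
  rw [ae_iff]
  simp only [ne_eq, not_not]
  refine le_antisymm (ge_of_tendsto' (ENNReal.tendsto_pow_atTop_nhds_zero_of_lt_one ?_) hle) zero_le
  simp

/-! ### Moments of scrambled numbers and of the maximum of two of them. -/

variable [IsProbabilityMeasure P]

lemma integral_ofDigits (x : ℕ → Fin 2) :
    ∫ ω, Real.ofDigits (scrambledDigit (fun a => σ a ω) x) ∂P = 1 / 2 := by
  have h := hasSum_integral_mul_ofDigits (P := P) (Z := fun _ => 1)
    (fun k => hσ.measurable_digit (digitPrefix x k) (x k)) measurable_const (by simp)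
  simp only [one_mul, hσ.integral_digit] at h
  exact (h.unique (hasSum_half_pow_succ.mul_right (1 / 2))).trans (one_mul _)

/-- Distinct digits have mixed moment `1/4`, while a digit equals its own square and has mean `1/2`;
the second summand is the diagonal excess. -/
lemma integral_ofDigits_mul_digit (x : ℕ → Fin 2) (k : ℕ) :
    ∫ ω, ((scrambledDigit (fun a => σ a ω) x k : ℕ) : ℝ) *
      Real.ofDigits (scrambledDigit (fun a => σ a ω) x) ∂P = 1 / 4 + (1 / 2) ^ (k + 1) / 4 := by
  have h := hasSum_integral_mul_ofDigits (P := P)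
    (Z := fun ω => ((scrambledDigit (fun a => σ a ω) x k : ℕ) : ℝ))
    (fun k => hσ.measurable_digit (digitPrefix x k) (x k))
    (measurable_fin_cast (hσ.measurable_digit (digitPrefix x k) (x k)))
    (fun ω => by rw [Nat.abs_cast]; exact fin_two_cast_le_one _)
  refine h.unique ?_
  have h2 := (hasSum_half_pow_succ.mul_right (1 / 4)).add
    (hasSum_ite_eq k ((1 / 2 : ℝ) ^ (k + 1) / 4))
  rw [one_mul] at h2
  refine hasSum_of_eq (fun l => ?_) h2
  rcases eq_or_ne l k with rfl | hl
  · simp only [scrambledDigit, fin_two_cast_mul_self, hσ.integral_digit, if_true]; ring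
  · simp only [scrambledDigit, hσ.integral_digit_mul_digit (digitPrefix_ne hl.symm x x), hl,
      if_false, add_zero]

lemma integral_ofDigits_sq (x : ℕ → Fin 2) :
    ∫ ω, Real.ofDigits (scrambledDigit (fun a => σ a ω) x) ^ 2 ∂P = 1 / 3 := by
  have hm := fun k => hσ.measurable_digit (digitPrefix x k) (x k)
  have h := hasSum_integral_mul_ofDigits (P := P)
    (Z := fun ω => Real.ofDigits (scrambledDigit (fun a => σ a ω) x)) hm (measurable_ofDigits hm)
    (fun ω => by rw [abs_of_nonneg (Real.ofDigits_nonneg _)]; exact Real.ofDigits_le_one _)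
  simp only [sq]
  refine h.unique ?_
  -- The total is `1/4 + (1/3)(1/4) = 1/3`.
  have h2 := (hasSum_half_pow_succ.mul_right (1 / 4)).add (hasSum_quarter_pow_succ.mul_right (1 / 4))
  norm_num only at h2
  refine hasSum_of_eq (fun k => ?_) h2
  have := hσ.integral_ofDigits_mul_digit x k
  simp only [mul_comm _ (Real.ofDigits _)] at this
  simp only [scrambledDigit] at this ⊢
  rw [this, show (1 / 4 : ℝ) = (1 / 2) * (1 / 2) by norm_num, mul_pow]
  ring

/-- Both numbers use the same permutations up to position `i`, so their scrambled digits agree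
before `i` and differ at `i`. The larger number has digit one at `i` and digits of mean `1/2`
elsewhere, an excess of `(1/2)·2^(-(i+1))` over the mean `1/2`. -/
lemma integral_max_ofDigits {x y : ℕ → Fin 2} {i : ℕ} (hi : x i ≠ y i)
    (h : ∀ l < i, x l = y l) :
    ∫ ω, max (Real.ofDigits (scrambledDigit (fun a => σ a ω) x))
      (Real.ofDigits (scrambledDigit (fun a => σ a ω) y)) ∂P = 1 / 2 + (1 / 2) ^ (i + 2) := by
  set X : ℕ → Ω → Fin 2 := fun k ω => scrambledDigit (fun a => σ a ω) x k
  set Y : ℕ → Ω → Fin 2 := fun k ω => scrambledDigit (fun a => σ a ω) y k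
  have hX : ∀ k, Measurable (X k) := fun k => hσ.measurable_digit _ _
  have hY : ∀ k, Measurable (Y k) := fun k => hσ.measurable_digit _ _
  have hXY : ∀ l < i, ∀ ω, X l ω = Y l ω := fun l hl ω => by
    simp only [X, Y, scrambledDigit, h l hl, digitPrefix_congr fun j hj => h j (hj.trans hl)]
  have hXYi : ∀ ω, X i ω ≠ Y i ω := fun ω => by
    simp only [X, Y, scrambledDigit, digitPrefix_congr h]
    exact fun e => hi ((σ _ ω).injective e)
  -- The digit sequence of the larger number, selected by digit `i` of the first one.
  let D : ℕ → Ω → Fin 2 := fun k ω => if X i ω = 1 then X k ω else Y k ω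
  have hD : ∀ k, Measurable (D k) := fun k =>
    Measurable.ite (hX i (measurableSet_singleton 1)) (hX k) (hY k)
  have hmax : ∀ ω, max (Real.ofDigits fun k => X k ω) (Real.ofDigits fun k => Y k ω) =
      1 * Real.ofDigits fun k => D k ω := fun ω => by
    have := hXYi ω
    by_cases hx : X i ω = 1
    · have hy : Y i ω = 0 := by omega
      simp only [D, hx, if_true, one_mul]
      exact max_eq_left (ofDigits_le_ofDigits (fun l hl => (hXY l hl ω).symm) hy hx)
    · have hx0 : X i ω = 0 := by omega
      have hy : Y i ω = 1 := by omega
      simp only [D, hx, if_false, one_mul]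
      exact max_eq_right (ofDigits_le_ofDigits (fun l hl => hXY l hl ω) hx0 hy)
  have key := hasSum_integral_mul_ofDigits (P := P) (Z := fun _ => 1) hD measurable_const (by simp)
  change ∫ ω, max (Real.ofDigits fun k => X k ω) (Real.ofDigits fun k => Y k ω) ∂P = _
  simp only [hmax]
  refine key.unique ?_
  have h2 := (hasSum_half_pow_succ.mul_right (1 / 2)).add
    (hasSum_ite_eq i ((1 / 2 : ℝ) ^ (i + 2)))
  rw [one_mul] at h2
  refine hasSum_of_eq (fun k => ?_) h2
  simp only [one_mul]
  rcases lt_trichotomy k i with hk | rfl | hk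
  · have : ∀ ω, D k ω = X k ω := fun ω => by simp [D, hXY k hk ω]
    simp only [this, hk.ne, if_false, add_zero]
    congr 1
    exact hσ.integral_digit _ _
  · have : ∀ ω, D k ω = 1 := fun ω => by
      have := hXYi ω
      simp only [D]; split_ifs with hx
      · exact hx
      · omega
    simp only [this, if_true]
    simp
    ring
  -- After `i` the selecting digit `X i` is independent of `X k` and of `Y k`, so the mean is `1/4 +
  -- (1/2 - 1/4)`. The joint law of `X k` and `Y k` is not needed.
  · have : ∀ ω, ((D k ω : ℕ) : ℝ) = ((X i ω : ℕ) : ℝ) * ((X k ω : ℕ) : ℝ) +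
        (((Y k ω : ℕ) : ℝ) - ((X i ω : ℕ) : ℝ) * ((Y k ω : ℕ) : ℝ)) := fun ω => by
      by_cases hx : X i ω = 1
      · simp [D, hx]
      · have hx0 : X i ω = 0 := by omega
        simp [D, hx0]
    have hb : ∀ {A : Ω → Fin 2}, Measurable A → Integrable (fun ω => ((A ω : ℕ) : ℝ)) P :=
      fun hA => integrable_of_abs_le_one (measurable_fin_cast hA) fun ω => by
        rw [Nat.abs_cast]; exact fin_two_cast_le_one _
    have hbb : ∀ {A B : Ω → Fin 2}, Measurable A → Measurable B →
        Integrable (fun ω => ((A ω : ℕ) : ℝ) * ((B ω : ℕ) : ℝ)) P :=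
      fun hA hB => integrable_of_abs_le_one
        ((measurable_fin_cast hA).mul (measurable_fin_cast hB)) fun ω => by
          rw [abs_mul, Nat.abs_cast, Nat.abs_cast]
          exact mul_le_one₀ (fin_two_cast_le_one _) (Nat.cast_nonneg _) (fin_two_cast_le_one _)
    simp only [this]
    have e1 : ∫ ω, ((X i ω : ℕ) : ℝ) * ((X k ω : ℕ) : ℝ) ∂P = 1 / 4 :=
      hσ.integral_digit_mul_digit (digitPrefix_ne hk.ne x x) _ _
    have e2 : ∫ ω, ((X i ω : ℕ) : ℝ) * ((Y k ω : ℕ) : ℝ) ∂P = 1 / 4 :=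
      hσ.integral_digit_mul_digit (digitPrefix_ne hk.ne x y) _ _
    have e3 : ∫ ω, ((Y k ω : ℕ) : ℝ) ∂P = 1 / 2 := hσ.integral_digit _ _
    have e4 := integral_add (hbb (hX i) (hX k)) ((hb (hY k)).sub (hbb (hX i) (hY k)))
    have e5 := integral_sub (hb (hY k)) (hbb (hX i) (hY k))
    simp only [Pi.sub_apply] at e4
    rw [e4, e5, e1, e2, e3, if_neg hk.ne']
    ring

lemma integrable_ofDigits (x : ℕ → Fin 2) :
    Integrable (fun ω => Real.ofDigits (scrambledDigit (fun a => σ a ω) x)) P :=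
  integrable_of_abs_le_one (measurable_ofDigits fun k => hσ.measurable_digit _ _) fun ω => by
    rw [abs_of_nonneg (Real.ofDigits_nonneg _)]; exact Real.ofDigits_le_one _

lemma integral_one_sub_max (x y : ℝ) :
    ∫ ω, (1 - max (scramble (fun a => σ a ω) x) (scramble (fun a => σ a ω) y)) ∂P =
      psiSeries (digitDifference (Real.digits x 2) (Real.digits y 2)) / 3 := by
  simp only [scramble_eq]
  set a := Real.digits x 2
  set b := Real.digits y 2
  have e := integral_sub (μ := P) (integrable_const (1 : ℝ))
    ((hσ.integrable_ofDigits a).sup (hσ.integrable_ofDigits b))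
  simp only [Pi.sup_apply] at e
  rw [e]
  by_cases h : a = b
  · have e : digitDifference a b = 0 := by
      ext1 k; simp [digitDifference, h]
    rw [e, psiSeries_zero, h]
    simp only [max_self, hσ.integral_ofDigits]
    simp; norm_num
  · have hex : ∃ k, a k ≠ b k := by
      by_contra! hc; exact h (funext hc)
    classical
    have h1 := Nat.find_spec hex
    have h2 : ∀ l < Nat.find hex, a l = b l := fun l hl => not_not.1 (Nat.find_min hex hl)
    rw [hσ.integral_max_ofDigits h1 h2, psiSeries_of_first_ne (i := Nat.find hex)
      (by simp [digitDifference, h1]) fun l hl => by simp [digitDifference, h2 l hl]]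
    simp; ring

end IsOwenTree

end Probability

/-! ### Independence of the coordinates -/

section Independence

variable {Ω : Type*} [MeasurableSpace Ω] {P : Measure Ω} {s : ℕ}
  {π : Fin s → List (Fin 2) → Ω → Equiv.Perm (Fin 2)}

lemma IsOwenScrambling.isOwenTree (hπ : IsOwenScrambling P π) (j : Fin s) :
    IsOwenTree P (π j) where
  measurable := hπ.measurable j
  indep := iIndepFun.precomp (g := fun a : List (Fin 2) => (j, a))
    (fun _ _ h => (Prod.ext_iff.1 h).2) hπ.indep
  uniform := hπ.uniform j

/-- The joint law of all permutations is an infinite product measure. Currying the index pairs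
regroups it as a product over coordinates of the laws of whole trees. -/
lemma IsOwenScrambling.iIndepFun_tree [IsProbabilityMeasure P] (hπ : IsOwenScrambling P π) :
    iIndepFun (fun j ω a => π j a ω) P := by
  have hm : ∀ j a, Measurable (π j a) := hπ.measurable
  have hm' : ∀ i : Fin s × List (Fin 2), Measurable (π i.1 i.2) := fun i => hm _ _
  have hmj : ∀ j, Measurable fun ω a => π j a ω := fun j => measurable_pi_lambda _ (hm j)
  have : ∀ j a, IsProbabilityMeasure (P.map (π j a)) :=
    fun j a => Measure.isProbabilityMeasure_map (hm j a).aemeasurable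
  have h1 := (iIndepFun_iff_map_fun_eq_infinitePi_map hm').1 hπ.indep
  rw [iIndepFun_iff_map_fun_eq_infinitePi_map hmj]
  have h2 : ∀ j, P.map (fun ω a => π j a ω) = Measure.infinitePi fun a => P.map (π j a) :=
    fun j => (iIndepFun_iff_map_fun_eq_infinitePi_map (hm j)).1 (hπ.isOwenTree j).indep
  simp only [h2]
  rw [← Measure.infinitePi_map_curry (fun j a => P.map (π j a)), ← h1,
    Measure.map_map (MeasurableEquiv.measurable _) (measurable_pi_lambda _ hm')]
  rfl

lemma IsOwenScrambling.integral_prod [IsProbabilityMeasure P] (hπ : IsOwenScrambling P π)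
    (u : Finset (Fin s)) {f : u → (List (Fin 2) → Equiv.Perm (Fin 2)) → ℝ}
    (hf : ∀ j, Measurable (f j)) :
    ∫ ω, ∏ j : u, f j (fun a => π j a ω) ∂P = ∏ j : u, ∫ ω, f j (fun a => π j a ω) ∂P :=
  (hπ.iIndepFun_tree.precomp (g := ((↑) : u → Fin s)) Subtype.val_injective).integral_fun_prod_comp
    (fun j => (measurable_pi_lambda _ (hπ.measurable j)).aemeasurable)
    fun j => (hf j).aestronglyMeasurable

end Independence

/-! ### The integral of the squared local discrepancy -/

/-- The indicator of `a < t`. -/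
def ltIndicator (a t : ℝ) : ℝ := if a < t then 1 else 0

lemma measurable_ltIndicator (a : ℝ) : Measurable (ltIndicator a) :=
  Measurable.ite measurableSet_Ioi measurable_const measurable_const

lemma abs_ltIndicator_le (a t : ℝ) : |ltIndicator a t| ≤ 1 := by
  unfold ltIndicator; split_ifs <;> simp

lemma setIntegral_ltIndicator_mul {a : ℝ} (ha : 0 ≤ a) (f : ℝ → ℝ) :
    ∫ t in Set.Icc (0 : ℝ) 1, ltIndicator a t * f t = ∫ t in Set.Ioc a 1, f t := by
  have h : ∀ t, ltIndicator a t * f t = (Set.Ioi a).indicator f t := fun t => by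
    by_cases ht : a < t <;> simp [ltIndicator, ht]
  simp only [h]
  rw [setIntegral_indicator measurableSet_Ioi]
  congr 2
  ext t
  simp only [Set.mem_inter_iff, Set.mem_Icc, Set.mem_Ioi, Set.mem_Ioc]
  constructor
  · rintro ⟨⟨_, h1⟩, h2⟩; exact ⟨h2, h1⟩
  · rintro ⟨h2, h1⟩; exact ⟨⟨(ha.trans_lt h2).le, h1⟩, h2⟩

lemma ltIndicator_mul_ltIndicator (a b t : ℝ) :
    ltIndicator a t * ltIndicator b t = ltIndicator (max a b) t * 1 := by
  by_cases ha : a < t <;> by_cases hb : b < t <;> simp [ltIndicator, ha, hb]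

lemma integral_ltIndicator_mul_ltIndicator {a b : ℝ} (ha : a ∈ Set.Icc (0 : ℝ) 1)
    (hb : b ∈ Set.Icc (0 : ℝ) 1) :
    ∫ t in Set.Icc (0 : ℝ) 1, ltIndicator a t * ltIndicator b t = 1 - max a b := by
  simp only [ltIndicator_mul_ltIndicator]
  rw [setIntegral_ltIndicator_mul (ha.1.trans (le_max_left _ _)) fun _ => 1]
  simp [ha.2, hb.2]

lemma integral_ltIndicator_mul_self {a : ℝ} (ha : a ∈ Set.Icc (0 : ℝ) 1) :
    ∫ t in Set.Icc (0 : ℝ) 1, ltIndicator a t * t = (1 - a ^ 2) / 2 := by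
  rw [setIntegral_ltIndicator_mul ha.1 fun t => t, ← intervalIntegral.integral_of_le ha.2,
    integral_id]
  norm_num

lemma integral_sq_unitInterval : ∫ t in Set.Icc (0 : ℝ) 1, t ^ 2 = 1 / 3 := by
  rw [integral_Icc_eq_integral_Ioc, ← intervalIntegral.integral_of_le zero_le_one, integral_pow]
  norm_num

/-- Coordinates outside `u` impose only `x n j < 1`, which holds by `hx`. -/
lemma localDiscrepancy_extendOne {N s : ℕ} {x : Fin N → Fin s → ℝ}
    (hx : ∀ n j, x n j ∈ Set.Ico (0 : ℝ) 1) (u : Finset (Fin s)) (t : u → ℝ) :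
    localDiscrepancy x (extendOne u t) =
      (∑ n, ∏ j : u, ltIndicator (x n j) (t j)) / N - ∏ j, t j := by
  classical
  have h1 : ∏ j, extendOne u t j = ∏ j : u, t j := by
    rw [← Finset.prod_subset (Finset.subset_univ u) fun j _ hj => by simp [extendOne, hj],
      ← Finset.prod_coe_sort]
    exact Finset.prod_congr rfl fun j _ => by simp [extendOne]
  have h2 : ∀ n, (∀ j, x n j ∈ Set.Ico 0 (extendOne u t j)) ↔ ∀ j : u, x n j < t j := by
    intro n
    constructor
    · intro h j
      simpa [extendOne] using (h j).2
    · intro h j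
      refine ⟨(hx n j).1, ?_⟩
      by_cases hj : j ∈ u
      · simpa [extendOne, hj] using h ⟨j, hj⟩
      · simpa [extendOne, hj] using (hx n j).2
  rw [localDiscrepancy, h1]
  congr 2
  simp only [h2]
  rw [Nat.card_eq_fintype_card, Fintype.card_subtype, Finset.card_filter, Nat.cast_sum]
  refine Finset.sum_congr rfl fun n _ => ?_
  simp only [ltIndicator]
  by_cases h : ∀ j : u, x n j < t j
  · simp [h]
  · rw [if_neg h]
    push Not at h
    obtain ⟨j, hj⟩ := h
    rw [Finset.prod_eq_zero (Finset.mem_univ j) (if_neg hj.not_gt)]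
    simp

lemma setIntegral_Icc_prod {ι : Type*} [Fintype ι] (f : ι → ℝ → ℝ) :
    ∫ t in Set.Icc (0 : ι → ℝ) 1, ∏ j, f j (t j) = ∏ j, ∫ t in Set.Icc (0 : ℝ) 1, f j t := by
  rw [← Set.pi_univ_Icc, volume_pi, Measure.restrict_pi_pi]
  exact integral_fintype_prod_eq_prod _

lemma integrableOn_Icc_prod {ι : Type*} [Fintype ι] {f : ι → ℝ → ℝ}
    (hf : ∀ j, IntegrableOn (f j) (Set.Icc (0 : ℝ) 1)) :
    IntegrableOn (fun t => ∏ j, f j (t j)) (Set.Icc (0 : ι → ℝ) 1) := by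
  rw [IntegrableOn, ← Set.pi_univ_Icc, volume_pi, Measure.restrict_pi_pi]
  exact Integrable.fintype_prod hf

lemma integrableOn_ltIndicator_mul (a : ℝ) {f : ℝ → ℝ} (hf : IntegrableOn f (Set.Icc (0 : ℝ) 1)) :
    IntegrableOn (fun t => ltIndicator a t * f t) (Set.Icc (0 : ℝ) 1) :=
  Integrable.bdd_mul hf (measurable_ltIndicator a).aestronglyMeasurable
    (ae_of_all _ (abs_ltIndicator_le a))

lemma integrableOn_ltIndicator (a : ℝ) : IntegrableOn (ltIndicator a) (Set.Icc (0 : ℝ) 1) := by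
  simpa using integrableOn_ltIndicator_mul a (f := fun _ => 1) (by simp)

lemma integral_mul_sub_mul_add {α : Type*} [MeasurableSpace α] {μ : Measure α} {f g h : α → ℝ}
    (hf : Integrable f μ) (hg : Integrable g μ) (hh : Integrable h μ) (a b : ℝ) :
    ∫ x, (a * f x - b * g x + h x) ∂μ = a * ∫ x, f x ∂μ - b * ∫ x, g x ∂μ + ∫ x, h x ∂μ := by
  have h1 := integral_add ((hf.const_mul a).sub (hg.const_mul b)) hh
  have h2 := integral_sub (hf.const_mul a) (hg.const_mul b)
  simp only [Pi.sub_apply] at h1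
  rw [h1, h2, integral_const_mul, integral_const_mul]

/-- Warnock's formula for the integral of the squared local discrepancy. -/
lemma integral_sq_localDiscrepancy {N s : ℕ} {x : Fin N → Fin s → ℝ}
    (hx : ∀ n j, x n j ∈ Set.Ico (0 : ℝ) 1) (u : Finset (Fin s)) :
    ∫ t in Set.Icc (0 : u → ℝ) 1, |localDiscrepancy x (extendOne u t)| ^ 2 =
      (1 / (N : ℝ) ^ 2) * ∑ n, ∑ n', ∏ j : u, (1 - max (x n j) (x n' j)) -
        (2 / (N : ℝ)) * ∑ n, ∏ j : u, ((1 - x n j ^ 2) / 2) + (1 / 3) ^ u.card := by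
  have hx' : ∀ n j, x n j ∈ Set.Icc (0 : ℝ) 1 := fun n j => Set.Ico_subset_Icc_self (hx n j)
  have hexp : ∀ t : u → ℝ, |localDiscrepancy x (extendOne u t)| ^ 2 =
      (1 / (N : ℝ) ^ 2) * ∑ n, ∑ n', ∏ j : u, (ltIndicator (x n j) (t j) *
        ltIndicator (x n' j) (t j)) -
        (2 / (N : ℝ)) * ∑ n, ∏ j : u, (ltIndicator (x n j) (t j) * t j) + ∏ j, t j ^ 2 := by
    intro t
    rw [localDiscrepancy_extendOne hx, sq_abs]
    simp only [Finset.prod_mul_distrib, Finset.prod_pow, ← Finset.mul_sum, ← Finset.sum_mul]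
    ring
  have hid : IntegrableOn (fun t : ℝ => t) (Set.Icc (0 : ℝ) 1) :=
    continuous_id.integrableOn_Icc
  have i1 : ∀ n n', IntegrableOn (fun t : u → ℝ => ∏ j : u, (ltIndicator (x n j) (t j) *
        ltIndicator (x n' j) (t j))) (Set.Icc (0 : u → ℝ) 1) := fun n n' =>
    integrableOn_Icc_prod (f := fun (j : u) t => ltIndicator (x n j) t * ltIndicator (x n' j) t)
      fun j => integrableOn_ltIndicator_mul _ (integrableOn_ltIndicator _)
  have i2 : ∀ n, IntegrableOn (fun t : u → ℝ => ∏ j : u, (ltIndicator (x n j) (t j) * t j))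
      (Set.Icc (0 : u → ℝ) 1) := fun n =>
    integrableOn_Icc_prod (f := fun (j : u) t => ltIndicator (x n j) t * t)
      fun j => integrableOn_ltIndicator_mul _ hid
  have i3 : IntegrableOn (fun t : u → ℝ => ∏ j, t j ^ 2) (Set.Icc (0 : u → ℝ) 1) :=
    integrableOn_Icc_prod (f := fun _ t => t ^ 2) fun j => (continuous_pow 2).integrableOn_Icc
  have i1' : ∀ n, IntegrableOn (fun t : u → ℝ => ∑ n', ∏ j : u, (ltIndicator (x n j) (t j) *
        ltIndicator (x n' j) (t j))) (Set.Icc (0 : u → ℝ) 1) := fun n =>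
    integrable_finsetSum _ fun n' _ => i1 n n'
  simp only [hexp]
  rw [integral_mul_sub_mul_add (integrable_finsetSum _ fun n _ => i1' n)
      (integrable_finsetSum _ fun n _ => i2 n) i3, integral_finsetSum _ fun n _ => i1' n,
    integral_finsetSum _ fun n _ => i2 n]
  congr 1
  · congr 2
    · refine Finset.sum_congr rfl fun n _ => ?_
      rw [integral_finsetSum _ fun n' _ => i1 n n']
      refine Finset.sum_congr rfl fun n' _ => ?_
      rw [setIntegral_Icc_prod fun (j : u) t => ltIndicator (x n j) t * ltIndicator (x n' j) t]
      exact Finset.prod_congr rfl fun j _ =>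
        integral_ltIndicator_mul_ltIndicator (hx' _ _) (hx' _ _)
    · refine Finset.sum_congr rfl fun n _ => ?_
      rw [setIntegral_Icc_prod fun (j : u) t => ltIndicator (x n j) t * t]
      exact Finset.prod_congr rfl fun j _ => integral_ltIndicator_mul_self (hx' _ _)
  · rw [setIntegral_Icc_prod fun (j : u) t => t ^ 2]
    simp [integral_sq_unitInterval]

/-! ### Laurent series of rational functions -/

lemma toLaurent_mul (f g : (ZMod 2)[X]) : toLaurent (f * g) = toLaurent f * toLaurent g :=
  map_mul _ f g

lemma toLaurent_add (f g : (ZMod 2)[X]) : toLaurent (f + g) = toLaurent f + toLaurent g :=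
  map_add _ f g

lemma toLaurent_zero : toLaurent 0 = 0 := map_zero _

lemma toLaurent_sum {ι : Type*} (s : Finset ι) (f : ι → (ZMod 2)[X]) :
    toLaurent (∑ i ∈ s, f i) = ∑ i ∈ s, toLaurent (f i) := map_sum _ f s

lemma toLaurent_X_pow (i : ℕ) :
    toLaurent (X ^ i) = HahnSeries.single (-(i : ℤ)) (1 : ZMod 2) := by
  simp [toLaurent, HahnSeries.single_pow]

lemma coeff_toLaurent (f : (ZMod 2)[X]) (l : ℤ) :
    (toLaurent f).coeff l = if l ≤ 0 then f.coeff l.natAbs else 0 := by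
  induction f using Polynomial.induction_on' with
  | add f g hf hg =>
    rw [toLaurent_add, HahnSeries.coeff_add, hf, hg]
    split_ifs <;> simp
  | monomial i c =>
    have : toLaurent (monomial i c) = HahnSeries.single (-(i : ℤ)) c := by
      rcases (by decide : ∀ c : ZMod 2, c = 0 ∨ c = 1) c with rfl | rfl
      · simp [toLaurent_zero]
      · exact (congrArg toLaurent (monomial_one_right_eq_X_pow i)).trans (toLaurent_X_pow i)
    rw [this, HahnSeries.coeff_single, coeff_monomial]
    split_ifs <;> first | rfl | omega

lemma coeff_one_toLaurent (f : (ZMod 2)[X]) : (toLaurent f).coeff 1 = 0 := by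
  simp [coeff_toLaurent]

lemma toLaurent_ne_zero {f : (ZMod 2)[X]} (hf : f ≠ 0) : toLaurent f ≠ 0 := fun h => by
  have h1 := coeff_toLaurent f (-(f.natDegree : ℤ))
  rw [h, if_pos (by omega), Int.natAbs_neg, Int.natAbs_natCast, HahnSeries.coeff_zero] at h1
  exact hf (leadingCoeff_eq_zero.1 h1.symm)

lemma order_toLaurent {f : (ZMod 2)[X]} (hf : f ≠ 0) :
    (toLaurent f).order = -(f.natDegree : ℤ) := by
  refine le_antisymm (HahnSeries.order_le_of_coeff_ne_zero ?_) ?_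
  · rw [coeff_toLaurent, if_pos (by omega), Int.natAbs_neg, Int.natAbs_natCast]
    exact leadingCoeff_ne_zero.2 hf
  · have h := HahnSeries.coeff_order_eq_zero.not.2 (toLaurent_ne_zero hf)
    rw [coeff_toLaurent] at h
    split_ifs at h with h0
    · have := le_natDegree_of_ne_zero h
      omega
    · exact absurd rfl h

lemma coeff_toLaurent_X_pow_mul (i : ℕ) (L : LaurentSeries (ZMod 2)) (l : ℤ) :
    (toLaurent (X ^ i) * L).coeff l = L.coeff (l + i) := by
  have := HahnSeries.coeff_single_mul_add (r := (1 : ZMod 2)) (x := L) (a := l + i) (b := -(i : ℤ))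
  rw [toLaurent_X_pow]
  simpa using this

/-- Multiplication by `X ^ i` shifts coefficients, so the digitwise inner product of `k` with the
expansion of `L` appears as a single coefficient of `x⁻¹`. -/
lemma coeff_toLaurent_truncPoly_mul (m k : ℕ) (L : LaurentSeries (ZMod 2)) :
    (toLaurent (truncPoly m k) * L).coeff 1 =
      ∑ i ∈ Finset.range m, if k.testBit i then L.coeff (i + 1) else 0 := by
  rw [truncPoly, toLaurent_sum, Finset.sum_mul, HahnSeries.coeff_sum]
  refine Finset.sum_congr rfl fun i _ => ?_
  split_ifs
  · rw [coeff_toLaurent_X_pow_mul, add_comm]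
  · simp [toLaurent_zero]

/-- The coefficient of `x⁻¹` in the Laurent series of `f / p`. -/
def residue (p f : (ZMod 2)[X]) : ZMod 2 := (toLaurent f / toLaurent p).coeff 1

lemma residue_add (p f g : (ZMod 2)[X]) : residue p (f + g) = residue p f + residue p g := by
  rw [residue, toLaurent_add, add_div, HahnSeries.coeff_add]; rfl

lemma residue_sum {ι : Type*} (s : Finset ι) (p : (ZMod 2)[X]) (f : ι → (ZMod 2)[X]) :
    residue p (∑ i ∈ s, f i) = ∑ i ∈ s, residue p (f i) := by
  simp only [residue, toLaurent_sum, Finset.sum_div, HahnSeries.coeff_sum]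

lemma residue_of_dvd {p f : (ZMod 2)[X]} (hp : p ≠ 0) (h : p ∣ f) : residue p f = 0 := by
  obtain ⟨c, rfl⟩ := h
  rw [residue, toLaurent_mul, mul_div_cancel_left₀ _ (toLaurent_ne_zero hp), coeff_one_toLaurent]

/-- Modulo `p`, `f` may be replaced by its nonzero remainder `r`. The leading term of `r / p` is at
`x^(-(deg p - deg r))`, and a power of `X` moves it to `x⁻¹`. -/
lemma exists_residue_X_pow_mul_ne_zero {p f : (ZMod 2)[X]} (hp : p ≠ 0) (h : ¬ p ∣ f) :
    ∃ a < p.natDegree, residue p (X ^ a * f) ≠ 0 := by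
  have hr : f % p ≠ 0 := fun e => h (EuclideanDomain.mod_eq_zero.1 e)
  have hdeg : (f % p).natDegree < p.natDegree := natDegree_lt_natDegree hr (degree_mod_lt f hp)
  have hL : toLaurent (f % p) / toLaurent p ≠ 0 :=
    div_ne_zero (toLaurent_ne_zero hr) (toLaurent_ne_zero hp)
  have hord : (toLaurent (f % p) / toLaurent p).order = p.natDegree - (f % p).natDegree := by
    have h1 := HahnSeries.order_mul hL (toLaurent_ne_zero hp)
    rw [div_mul_cancel₀ _ (toLaurent_ne_zero hp), order_toLaurent hr, order_toLaurent hp] at h1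
    omega
  refine ⟨p.natDegree - (f % p).natDegree - 1, by omega, ?_⟩
  have e : X ^ (p.natDegree - (f % p).natDegree - 1) * f =
      X ^ (p.natDegree - (f % p).natDegree - 1) * (f % p) +
        p * (X ^ (p.natDegree - (f % p).natDegree - 1) * (f / p)) := by
    rw [mul_left_comm p, ← mul_add, EuclideanDomain.mod_add_div]
  rw [e, residue_add, residue_of_dvd hp (dvd_mul_right _ _), add_zero, residue, toLaurent_mul,
    mul_div_assoc, coeff_toLaurent_X_pow_mul]
  have h2 := HahnSeries.coeff_order_eq_zero.not.2 hL
  rw [hord] at h2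
  convert! h2 using 2
  omega

/-! ### Character sums over the polynomial lattice -/

lemma truncPoly_eq_of_lt {k M M' : ℕ} (h : k < 2 ^ M) (h' : k < 2 ^ M') :
    truncPoly M k = truncPoly M' k := by
  have key : ∀ M M' : ℕ, k < 2 ^ M → M ≤ M' → truncPoly M k = truncPoly M' k := by
    intro M M' h1 h2
    refine Finset.sum_subset (by simpa using h2) fun i _ hi => ?_
    rw [Nat.testBit_lt_two_pow (h1.trans_le (Nat.pow_le_pow_right (by norm_num)
      (by simpa using hi)))]
    simp
  rcases le_total M M' with hM | hM
  · exact key M M' h hM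
  · exact (key M' M h' hM).symm

lemma natPoly_eq_truncPoly {m n : ℕ} (h : n < 2 ^ m) : natPoly n = truncPoly m n :=
  truncPoly_eq_of_lt n.lt_size_self h

/-- Binary `xor` is addition in `𝔽₂[x]`, so adding `X ^ a` permutes the indices below `2 ^ m`. -/
lemma truncPoly_xor_two_pow {m a : ℕ} (n : ℕ) (ha : a < m) :
    truncPoly m (n ^^^ 2 ^ a) = truncPoly m n + X ^ a := by
  have : (X ^ a : (ZMod 2)[X]) = ∑ i ∈ Finset.range m, if i = a then X ^ i else 0 := by
    rw [Finset.sum_ite_eq' (Finset.range m) a, if_pos (Finset.mem_range.2 ha)]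
  rw [this, truncPoly, truncPoly, ← Finset.sum_add_distrib]
  refine Finset.sum_congr rfl fun i _ => ?_
  rw [Nat.testBit_xor, Nat.testBit_two_pow]
  rcases eq_or_ne i a with rfl | hi
  · cases n.testBit i <;> simp [CharTwo.add_self_eq_zero]
  · simp [hi, hi.symm]

/-- If `p ∤ f`, some translation of `n(x)` by `X ^ a` with `a < m` flips the sign of every summand,
so the sum equals its own negative. -/
lemma sum_sign_residue {m : ℕ} {p : (ZMod 2)[X]} (hp : p ≠ 0) (hpm : p.natDegree = m)
    (f : (ZMod 2)[X]) [Decidable (p ∣ f)] :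
    ∑ n : Fin (2 ^ m), sign (residue p (natPoly n * f)) = if p ∣ f then 2 ^ m else 0 := by
  split_ifs with h
  · simp [residue_of_dvd hp (h.mul_left _)]
  · obtain ⟨a, ha, hres⟩ := exists_residue_X_pow_mul_ne_zero hp h
    rw [hpm] at ha
    have hlt : ∀ n : Fin (2 ^ m), (n : ℕ) ^^^ 2 ^ a < 2 ^ m := fun n =>
      Nat.xor_lt_two_pow n.2 (Nat.pow_lt_pow_right (by norm_num) ha)
    let e : Fin (2 ^ m) ≃ Fin (2 ^ m) :=
      Function.Involutive.toPerm (fun n => ⟨(n : ℕ) ^^^ 2 ^ a, hlt n⟩) fun n => by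
        ext; simp
    have hs : sign (residue p (X ^ a * f)) = -1 := by simp [sign, hres]
    have he : ∀ n, sign (residue p (natPoly (e n) * f)) =
        -sign (residue p (natPoly n * f)) := fun n => by
      have h1 : natPoly (e n) = natPoly n + X ^ a := by
        rw [natPoly_eq_truncPoly (e n).2, natPoly_eq_truncPoly n.2]
        exact truncPoly_xor_two_pow n ha
      rw [h1, add_mul, residue_add, sign_add, hs]; ring
    have h2 := e.sum_comp fun n => sign (residue p (natPoly n * f))
    simp only [he, Finset.sum_neg_distrib] at h2
    linarith

/-! ### Digits of the polynomial lattice points -/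

lemma digits_half_zero (c : Fin 2) {x : ℝ} (hx : x ∈ Set.Ico (0 : ℝ) 1) :
    Real.digits ((((c : ℕ) : ℝ) + x) / 2) 2 0 = c := by
  have : (((c : ℕ) : ℝ) + x) / 2 * ((2 : ℕ) : ℝ) ^ (0 + 1) = x + (c : ℕ) := by
    push_cast; ring
  rw [Real.digits, this, Nat.floor_add_natCast hx.1, Nat.floor_eq_zero.2 hx.2]
  ext; simp [Fin.ofNat]; omega

lemma digits_half_succ (c : Fin 2) {x : ℝ} (hx : x ∈ Set.Ico (0 : ℝ) 1) (i : ℕ) :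
    Real.digits ((((c : ℕ) : ℝ) + x) / 2) 2 (i + 1) = Real.digits x 2 i := by
  have : (((c : ℕ) : ℝ) + x) / 2 * ((2 : ℕ) : ℝ) ^ (i + 1 + 1) =
      x * ((2 : ℕ) : ℝ) ^ (i + 1) + ((2 * (c * 2 ^ i) : ℕ) : ℝ) := by
    push_cast; ring
  rw [Real.digits, this, Nat.floor_add_natCast (mul_nonneg hx.1 (by positivity)), Real.digits]
  ext; simp [Fin.ofNat]

/-- The induction strips the leading digit: the sum is half of the first digit plus the sum for the
shifted sequence. -/
lemma digits_sum (m : ℕ) (c : ℕ → Fin 2) :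
    (∑ i ∈ Finset.range m, ((c i : ℕ) : ℝ) / 2 ^ (i + 1)) ∈ Set.Ico (0 : ℝ) 1 ∧
    ∀ i, Real.digits (∑ i ∈ Finset.range m, ((c i : ℕ) : ℝ) / 2 ^ (i + 1)) 2 i =
      if i < m then c i else 0 := by
  induction m generalizing c with
  | zero => simp [Real.digits]
  | succ m ih =>
    obtain ⟨h1, h2⟩ := ih fun i => c (i + 1)
    have e : ∑ i ∈ Finset.range (m + 1), ((c i : ℕ) : ℝ) / 2 ^ (i + 1) =
        (((c 0 : ℕ) : ℝ) + ∑ i ∈ Finset.range m, ((c (i + 1) : ℕ) : ℝ) / 2 ^ (i + 1)) / 2 := by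
      rw [Finset.sum_range_succ', add_div, Finset.sum_div, add_comm]
      congr 1
      · simp
      · exact Finset.sum_congr rfl fun i _ => by rw [pow_succ _ (i + 1)]; field_simp
    rw [e]
    refine ⟨⟨by have := h1.1; positivity, ?_⟩, fun i => ?_⟩
    · have := fin_two_cast_le_one (c 0)
      linarith [h1.2]
    · cases i with
      | zero => rw [digits_half_zero _ h1]; simp
      | succ i => rw [digits_half_succ _ h1, h2]; simp

/-- The binary digits of the polynomial lattice points. -/
def latticeDigit {s : ℕ} (m : ℕ) (p : (ZMod 2)[X]) (q : Fin s → (ZMod 2)[X]) (n : ℕ) (j : Fin s)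
    (i : ℕ) : ZMod 2 :=
  if i < m then (toLaurent (natPoly n * q j) / toLaurent p).coeff (i + 1) else 0

lemma digits_truncEval (m : ℕ) (L : LaurentSeries (ZMod 2)) (i : ℕ) :
    Real.digits (truncEval m L) 2 i = if i < m then (L.coeff (i + 1) : Fin 2) else 0 := by
  have : truncEval m L = ∑ i ∈ Finset.range m,
      (((show Fin 2 from L.coeff (i + 1)) : ℕ) : ℝ) / 2 ^ (i + 1) := by
    have e : Finset.Icc 1 m = (Finset.range m).image (· + 1) := by
      ext l
      simp only [Finset.mem_Icc, Finset.mem_image, Finset.mem_range]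
      exact ⟨fun h => ⟨l - 1, by omega, by omega⟩, by rintro ⟨i, hi, rfl⟩; omega⟩
    rw [truncEval, e, Finset.sum_image fun _ _ _ _ h => Nat.succ_injective h]
    refine Finset.sum_congr rfl fun i _ => ?_
    push_cast
    rfl
  rw [this]
  exact (digits_sum m fun i => (L.coeff (i + 1) : Fin 2)).2 i

lemma digitDifference_lattice {s : ℕ} (m : ℕ) (p : (ZMod 2)[X]) (q : Fin s → (ZMod 2)[X])
    (n n' : Fin (2 ^ m)) (j : Fin s) :
    digitDifference (Real.digits (polyLatticePoint m p q n j) 2)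
      (Real.digits (polyLatticePoint m p q n' j) 2) =
      fun i => latticeDigit m p q n j i + latticeDigit m p q n' j i := by
  have h : ∀ a b : ZMod 2, (if a = b then (0 : ZMod 2) else 1) = a + b := by decide
  ext1 i
  rw [← h]
  have hd : ∀ n : Fin (2 ^ m), Real.digits (polyLatticePoint m p q n j) 2 i =
      latticeDigit m p q n j i := fun n => digits_truncEval m _ i
  by_cases he : latticeDigit m p q n j i = latticeDigit m p q n' j i
  · rw [if_pos he, digitDifference, if_pos ((hd n).trans (he.trans (hd n').symm))]
  · rw [if_neg he, digitDifference, if_neg fun e => he ((hd n).symm.trans (e.trans (hd n')))]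

lemma sum_latticeDigit {s : ℕ} (m : ℕ) (p : (ZMod 2)[X]) (q : Fin s → (ZMod 2)[X]) (n : ℕ)
    (j : Fin s) (k : ℕ) :
    ∑ i ∈ Finset.range m, (if k.testBit i then latticeDigit m p q n j i else 0) =
      residue p (natPoly n * (truncPoly m k * q j)) := by
  rw [residue, show natPoly n * (truncPoly m k * q j) = truncPoly m k * (natPoly n * q j) by ring,
    toLaurent_mul, mul_div_assoc, coeff_toLaurent_truncPoly_mul]
  refine Finset.sum_congr rfl fun i hi => ?_
  rw [latticeDigit, if_pos (Finset.mem_range.1 hi)]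

/-- Over `𝔽₂` the digitwise difference is a sum, so the Walsh functions split into one factor per
point. Lattice points have only `m` digits, so only `truncPoly m (k j)` matters, and the exponents
add up to a residue. -/
lemma prod_walsh_lattice {s : ℕ} (m : ℕ) (p : (ZMod 2)[X]) (q : Fin s → (ZMod 2)[X])
    (n n' : Fin (2 ^ m)) (k : Fin s → ℕ) :
    ∏ j, walsh (k j) (digitDifference (Real.digits (polyLatticePoint m p q n j) 2)
      (Real.digits (polyLatticePoint m p q n' j) 2)) =
      sign (residue p (natPoly n * ∑ j, truncPoly m (k j) * q j)) *
        sign (residue p (natPoly n' * ∑ j, truncPoly m (k j) * q j)) := by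
  have h : ∀ n : ℕ, residue p (natPoly n * ∑ j, truncPoly m (k j) * q j) =
      ∑ j, ∑ i ∈ Finset.range m, (if (k j).testBit i then latticeDigit m p q n j i else 0) :=
    fun n => by
      rw [Finset.mul_sum, residue_sum]
      exact Finset.sum_congr rfl fun j _ => (sum_latticeDigit m p q n j (k j)).symm
  rw [h, h, ← sign_add, ← Finset.sum_add_distrib, sign_sum]
  refine Finset.prod_congr rfl fun j _ => ?_
  rw [digitDifference_lattice, walsh_eq_sign_sum (m := m), ← Finset.sum_add_distrib]
  · congr 1
    exact Finset.sum_congr rfl fun i _ => by split_ifs <;> simp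
  · intro i hi
    simp [latticeDigit, hi.not_gt]

/-- The character property of polynomial lattices. -/
lemma mean_prod_walsh_lattice {s m : ℕ} {p : (ZMod 2)[X]} (hp : p ≠ 0) (hpm : p.natDegree = m)
    (q : Fin s → (ZMod 2)[X]) (k : Fin s → ℕ) :
    (1 / ((2 ^ m : ℕ) : ℝ) ^ 2) * ∑ n : Fin (2 ^ m), ∑ n' : Fin (2 ^ m),
      ∏ j, walsh (k j) (digitDifference (Real.digits (polyLatticePoint m p q n j) 2)
        (Real.digits (polyLatticePoint m p q n' j) 2)) = (dualLattice m p q).indicator 1 k := by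
  classical
  -- The double sum over pairs factors into the square of one character sum, which is `2 ^ m` or
  -- zero.
  simp only [prod_walsh_lattice, ← Finset.sum_mul_sum, sum_sign_residue hp hpm]
  by_cases h : k ∈ dualLattice m p q
  · have h' : p ∣ ∑ j, truncPoly m (k j) * q j := h
    rw [Set.indicator_of_mem h, if_pos h']
    have : (2 : ℝ) ^ m ≠ 0 := by positivity
    simp [sq]
    field_simp
  · have h' : ¬ p ∣ ∑ j, truncPoly m (k j) * q j := h
    rw [Set.indicator_of_notMem h, if_neg h']
    simp

/-! ### The expected discrepancy of a scrambled point set -/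

section Expectation

variable {Ω : Type*} [MeasurableSpace Ω] {P : Measure Ω} {s N : ℕ}
  {π : Fin s → List (Fin 2) → Ω → Equiv.Perm (Fin 2)}

lemma sq_weightedL2Discrepancy {γ : Finset (Fin s) → ℝ} (hγ : ∀ u, 0 ≤ γ u)
    (x : Fin N → Fin s → ℝ) :
    weightedL2Discrepancy γ x ^ 2 = ∑ u : Finset (Fin s) with u.Nonempty,
      γ u * ∫ t in Set.Icc (0 : u → ℝ) 1, |localDiscrepancy x (extendOne u t)| ^ 2 :=
  Real.sq_sqrt <| Finset.sum_nonneg fun u _ =>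
    mul_nonneg (hγ u) (integral_nonneg fun _ => by positivity)

lemma IsOwenScrambling.ae_scramblePoints_mem_Ico (hπ : IsOwenScrambling P π)
    (x : Fin N → Fin s → ℝ) :
    ∀ᵐ ω ∂P, ∀ n j, scramblePoints (fun j a => π j a ω) x n j ∈ Set.Ico (0 : ℝ) 1 := by
  simp only [ae_all_iff]
  intro n j
  filter_upwards [(hπ.isOwenTree j).ae_ofDigits_ne_one (Real.digits (x n j) 2)] with ω hω
  exact ⟨scramble_nonneg _ _, (scramble_le_one _ _).lt_of_ne hω⟩

lemma IsOwenScrambling.integral_sq_localDiscrepancy [IsProbabilityMeasure P]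
    (hπ : IsOwenScrambling P π) (hN : N ≠ 0)
    (x : Fin N → Fin s → ℝ) (u : Finset (Fin s)) :
    Integrable (fun ω => ∫ t in Set.Icc (0 : u → ℝ) 1,
      |localDiscrepancy (scramblePoints (fun j a => π j a ω) x) (extendOne u t)| ^ 2) P ∧
    ∫ ω, (∫ t in Set.Icc (0 : u → ℝ) 1,
      |localDiscrepancy (scramblePoints (fun j a => π j a ω) x) (extendOne u t)| ^ 2) ∂P =
      ((1 / (N : ℝ) ^ 2) * ∑ n, ∑ n', ∏ j ∈ u,
        psiSeries (digitDifference (Real.digits (x n j) 2) (Real.digits (x n' j) 2)) - 1) /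
          3 ^ u.card := by
  set y : Ω → Fin N → Fin s → ℝ := fun ω => scramblePoints (fun j a => π j a ω) x
  have hmπ : ∀ j : Fin s, Measurable fun ω a => π j a ω := fun j =>
    measurable_pi_lambda _ (hπ.measurable j)
  have hmf : ∀ (n n' : Fin N) (j : Fin s), Measurable fun σ : List (Fin 2) → Equiv.Perm (Fin 2) =>
      1 - max (scramble σ (x n j)) (scramble σ (x n' j)) := fun n n' j =>
    measurable_const.sub ((measurable_scramble _).max (measurable_scramble _))
  have hmg : ∀ (n : Fin N) (j : Fin s), Measurable fun σ : List (Fin 2) → Equiv.Perm (Fin 2) =>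
      (1 - scramble σ (x n j) ^ 2) / 2 := fun n j =>
    (measurable_const.sub ((measurable_scramble _).pow_const 2)).div_const 2
  have hy0 : ∀ ω n j, 0 ≤ y ω n j := fun ω n j => scramble_nonneg _ _
  have hy1 : ∀ ω n j, y ω n j ≤ 1 := fun ω n j => scramble_le_one _ _
  have i1 : ∀ n n', Integrable (fun ω => ∏ j : u, (1 - max (y ω n j) (y ω n' j))) P := by
    intro n n'
    refine integrable_of_abs_le_one
      (Finset.measurable_fun_prod _ fun j _ => (hmf n n' j).comp (hmπ j)) fun ω => ?_
    rw [Finset.abs_prod]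
    refine Finset.prod_le_one (fun _ _ => abs_nonneg _) fun j _ => ?_
    rw [abs_of_nonneg (sub_nonneg.2 (max_le (hy1 _ _ _) (hy1 _ _ _)))]
    linarith [le_max_left (y ω n j) (y ω n' j), hy0 ω n j]
  have i2 : ∀ n, Integrable (fun ω => ∏ j : u, ((1 - y ω n j ^ 2) / 2)) P := by
    intro n
    refine integrable_of_abs_le_one
      (Finset.measurable_fun_prod _ fun j _ => (hmg n j).comp (hmπ j)) fun ω => ?_
    rw [Finset.abs_prod]
    refine Finset.prod_le_one (fun _ _ => abs_nonneg _) fun j _ => ?_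
    have h1 := hy0 ω n j
    have h2 := hy1 ω n j
    rw [abs_le]
    constructor <;> nlinarith
  have i1' : ∀ n, Integrable (fun ω => ∑ n', ∏ j : u, (1 - max (y ω n j) (y ω n' j))) P :=
    fun n => integrable_finsetSum _ fun n' _ => i1 n n'
  have i1'' : Integrable (fun ω => ∑ n, ∑ n', ∏ j : u, (1 - max (y ω n j) (y ω n' j))) P :=
    integrable_finsetSum _ fun n _ => i1' n
  have i2' : Integrable (fun ω => ∑ n, ∏ j : u, ((1 - y ω n j ^ 2) / 2)) P :=
    integrable_finsetSum _ fun n _ => i2 n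
  have hae : (fun ω => ∫ t in Set.Icc (0 : u → ℝ) 1, |localDiscrepancy (y ω) (extendOne u t)| ^ 2)
      =ᵐ[P] fun ω => (1 / (N : ℝ) ^ 2) * ∑ n, ∑ n', ∏ j : u, (1 - max (y ω n j) (y ω n' j)) -
        (2 / (N : ℝ)) * ∑ n, ∏ j : u, ((1 - y ω n j ^ 2) / 2) + (1 / 3) ^ u.card := by
    -- The right-hand side of Warnock's formula is bounded and measurable in `ω`, so this almost
    -- sure identity also yields integrability.
    filter_upwards [hπ.ae_scramblePoints_mem_Ico x] with ω hω
    exact PolyLat.integral_sq_localDiscrepancy hω u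
  refine ⟨Integrable.congr (((i1''.const_mul _).sub (i2'.const_mul _)).add
    (integrable_const _)) hae.symm, ?_⟩
  rw [integral_congr_ae hae, integral_mul_sub_mul_add i1'' i2' (integrable_const _),
    integral_finsetSum _ fun n _ => i1' n, integral_finsetSum _ fun n _ => i2 n]
  have e1 : ∀ n n', ∫ ω, ∏ j : u, (1 - max (y ω n j) (y ω n' j)) ∂P = (∏ j ∈ u,
      psiSeries (digitDifference (Real.digits (x n j) 2) (Real.digits (x n' j) 2))) /
        3 ^ u.card := by
    intro n n'
    refine (hπ.integral_prod u (f := fun j σ => 1 - max (scramble σ (x n j)) (scramble σ (x n' j)))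
      fun j => hmf n n' j).trans ?_
    simp only [(hπ.isOwenTree _).integral_one_sub_max]
    rw [Finset.prod_div_distrib, Finset.prod_const, Finset.card_univ, Fintype.card_coe,
      Finset.prod_coe_sort u fun j =>
        psiSeries (digitDifference (Real.digits (x n j) 2) (Real.digits (x n' j) 2))]
  have e2 : ∀ n, ∫ ω, ∏ j : u, ((1 - y ω n j ^ 2) / 2) ∂P = 1 / 3 ^ u.card := by
    intro n
    refine (hπ.integral_prod u (f := fun j σ => (1 - scramble σ (x n j) ^ 2) / 2)
      fun j => hmg n j).trans ?_
    have : ∀ j : u, ∫ ω, (1 - scramble (fun a => π j a ω) (x n j) ^ 2) / 2 ∂P = 1 / 3 := fun j => by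
      have h := (hπ.isOwenTree j).integral_ofDigits_sq (Real.digits (x n j) 2)
      have hi : Integrable (fun ω => scramble (fun a => π j a ω) (x n j) ^ 2) P :=
        integrable_of_abs_le_one (((measurable_scramble _).comp (hmπ j)).pow_const 2) fun ω => by
          rw [abs_pow, abs_of_nonneg (scramble_nonneg _ _)]
          exact pow_le_one₀ (scramble_nonneg _ _) (scramble_le_one _ _)
      simp only [← scramble_eq] at h
      rw [integral_div, integral_sub (integrable_const _) hi, h]
      simp; norm_num
    simp only [this]
    simp
  have e3 : ∀ n, ∫ ω, ∑ n', ∏ j : u, (1 - max (y ω n j) (y ω n' j)) ∂P = ∑ n', (∏ j ∈ u,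
      psiSeries (digitDifference (Real.digits (x n j) 2) (Real.digits (x n' j) 2))) /
        3 ^ u.card := fun n => by
    rw [integral_finsetSum _ fun n' _ => i1 n n']
    exact Finset.sum_congr rfl fun n' _ => e1 n n'
  have hN' : (N : ℝ) ≠ 0 := Nat.cast_ne_zero.2 hN
  simp only [e2, e3, ← Finset.sum_div, Finset.sum_const, Finset.card_univ, Fintype.card_fin,
    integral_const, probReal_univ, one_smul, one_div, inv_pow, nsmul_eq_mul]
  field_simp
  ring

end Expectation

/-! ### The sum over the dual lattice -/

lemma prod_extendZero {s : ℕ} (v : Finset (Fin s)) (k : v → ℕ+) {f : Fin s → ℕ → ℝ}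
    (hf : ∀ j, f j 0 = 1) : ∏ j, f j (extendZero v k j) = ∏ j : v, f j (k j) := by
  rw [← Finset.prod_subset (Finset.subset_univ v) fun j _ hj => by simp [extendZero, hj, hf],
    ← Finset.prod_coe_sort]
  exact Finset.prod_congr rfl fun j _ => by simp [extendZero]

/-- The mean over all pairs of points of the products of the Walsh series without constant
terms. -/
def pairMean {s : ℕ} (m : ℕ) (p : (ZMod 2)[X]) (q : Fin s → (ZMod 2)[X]) (v : Finset (Fin s)) :
    ℝ :=
  (1 / ((2 ^ m : ℕ) : ℝ) ^ 2) * ∑ n : Fin (2 ^ m), ∑ n' : Fin (2 ^ m), ∏ j ∈ v,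
    (psiSeries (digitDifference (Real.digits (polyLatticePoint m p q n j) 2)
      (Real.digits (polyLatticePoint m p q n' j) 2)) - 1)

/-- Each pair of points contributes a product of absolutely convergent series over positive `k`.
Averaging the finitely many pairs termwise leaves `psiVec` times the indicator of the dual lattice.
-/
lemma hasSum_dualLattice {s m : ℕ} {p : (ZMod 2)[X]} (hp : p ≠ 0) (hpm : p.natDegree = m)
    (q : Fin s → (ZMod 2)[X]) (v : Finset (Fin s)) :
    HasSum (fun k : {k : v → ℕ+ // extendZero v k ∈ dualLattice m p q} =>
      psiVec (extendZero v k.1)) (pairMean m p q v) := by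
  let b : Fin (2 ^ m) → Fin (2 ^ m) → Fin s → ℕ → ZMod 2 := fun n n' j =>
    digitDifference (Real.digits (polyLatticePoint m p q n j) 2)
      (Real.digits (polyLatticePoint m p q n' j) 2)
  have h1 : ∀ n n', HasSum (fun k : v → ℕ+ => ∏ j : v, (psi (k j) * walsh (k j) (b n n' j)))
      (∏ j ∈ v, (psiSeries (b n n' j) - 1)) := fun n n' => by
    rw [← Finset.prod_coe_sort]
    refine hasSum_pi_prod (fun (j : v) (k : ℕ+) => psi k * walsh k (b n n' j)) _ (fun j => ?_)
      fun j => hasSum_pnat_psi_mul_walsh _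
    simp only [norm_mul, Real.norm_eq_abs, abs_walsh, mul_one, abs_of_nonneg (psi_nonneg _)]
    exact summable_psi.comp_injective PNat.coe_injective
  have h2 := (hasSum_sum (s := Finset.univ) fun n (_ : n ∈ Finset.univ) =>
    hasSum_sum (s := Finset.univ) fun n' (_ : n' ∈ Finset.univ) => h1 n n').mul_left
      (1 / ((2 ^ m : ℕ) : ℝ) ^ 2)
  refine (hasSum_subtype_iff_indicator (f := fun k : v → ℕ+ => psiVec (extendZero v k))
    (s := {k | extendZero v k ∈ dualLattice m p q})).2 (hasSum_of_eq (fun k => ?_) h2)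
  have h3 : psiVec (extendZero v k) = ∏ j : v, psi (k j) :=
    prod_extendZero v k (f := fun _ => psi) fun _ => psi_zero
  have h4 : ∀ n n', ∏ j : v, walsh (k j) (b n n' j) =
      ∏ j, walsh (extendZero v k j) (b n n' j) := fun n n' =>
    (prod_extendZero v k (f := fun j l => walsh l (b n n' j)) fun _ => walsh_zero _).symm
  have h5 := mean_prod_walsh_lattice hp hpm q (extendZero v k)
  simp only [Finset.prod_mul_distrib, h4, ← h3, ← Finset.mul_sum]
  rw [mul_left_comm, h5]
  by_cases hk : extendZero v k ∈ dualLattice m p q <;> simp [Set.indicator, hk]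

lemma sum_pairMean {s : ℕ} (m : ℕ) (p : (ZMod 2)[X]) (q : Fin s → (ZMod 2)[X])
    (u : Finset (Fin s)) :
    ∑ v ∈ u.powerset with v.Nonempty, pairMean m p q v =
      (1 / ((2 ^ m : ℕ) : ℝ) ^ 2) * ∑ n : Fin (2 ^ m), ∑ n' : Fin (2 ^ m), ∏ j ∈ u,
        psiSeries (digitDifference (Real.digits (polyLatticePoint m p q n j) 2)
          (Real.digits (polyLatticePoint m p q n' j) 2)) - 1 := by
  have h0 : pairMean m p q ∅ = 1 := by
    have : (2 : ℝ) ^ m ≠ 0 := by positivity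
    simp [pairMean]
    field_simp
  have h1 : ∑ v ∈ u.powerset, pairMean m p q v =
      (1 / ((2 ^ m : ℕ) : ℝ) ^ 2) * ∑ n : Fin (2 ^ m), ∑ n' : Fin (2 ^ m), ∏ j ∈ u,
        psiSeries (digitDifference (Real.digits (polyLatticePoint m p q n j) 2)
          (Real.digits (polyLatticePoint m p q n' j) 2)) := by
    simp only [pairMean]
    rw [← Finset.mul_sum, Finset.sum_comm]
    congr 1
    refine Finset.sum_congr rfl fun n _ => ?_
    rw [Finset.sum_comm]
    refine Finset.sum_congr rfl fun n' _ => ?_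
    -- With `S` the Walsh series, `∏ S = ∏ ((S - 1) + 1)` expands over the subsets `v` of `u`.
    rw [← Finset.prod_add_one]
    simp
  rw [← h1, ← h0, ← Finset.sum_erase_eq_sub (Finset.empty_mem_powerset u)]
  refine Finset.sum_congr ?_ fun _ _ => rfl
  ext v
  simp [Finset.nonempty_iff_ne_empty, and_comm]

end PolyLat

end

/-! ### Assembly: the weighted sum over `u` and the regrouping by `v`. -/

theorem mainTheorem3 {Ω : Type*} [MeasurableSpace Ω] (P : Measure Ω) [IsProbabilityMeasure P]
    (m s : ℕ) (hm : 1 ≤ m) (hs : 1 ≤ s)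
    (p : (ZMod 2)[X]) (hp : Irreducible p) (hpm : p.natDegree = m)
    (q : Fin s → (ZMod 2)[X])
    (γ : Finset (Fin s) → ℝ) (hγ : ∀ u, 0 ≤ γ u)
    (π : Fin s → List (Fin 2) → Ω → Equiv.Perm (Fin 2))
    (hπ : PolyLat.IsOwenScrambling P π) :
    (∀ v : Finset (Fin s), v.Nonempty →
      Summable fun k : {k : v → ℕ+ // PolyLat.extendZero v k ∈ PolyLat.dualLattice m p q} =>
        PolyLat.psiVec (PolyLat.extendZero v k.1)) ∧
    Integrable (fun ω => PolyLat.weightedL2Discrepancy γ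
      (PolyLat.scramblePoints (fun j a => π j a ω) (PolyLat.polyLatticePoint m p q)) ^ 2) P ∧
    ∫ ω, PolyLat.weightedL2Discrepancy γ
        (PolyLat.scramblePoints (fun j a => π j a ω) (PolyLat.polyLatticePoint m p q)) ^ 2 ∂P =
      ∑ v : Finset (Fin s) with v.Nonempty, PolyLat.gammaTilde γ v *
        ∑' k : {k : v → ℕ+ // PolyLat.extendZero v k ∈ PolyLat.dualLattice m p q},
          PolyLat.psiVec (PolyLat.extendZero v k.1) := by
  classical
  have hp0 : p ≠ 0 := hp.ne_zero
  have hsum := fun v : Finset (Fin s) => PolyLat.hasSum_dualLattice hp0 hpm q v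
  have key := fun u : Finset (Fin s) =>
    hπ.integral_sq_localDiscrepancy (pow_ne_zero m two_ne_zero) (PolyLat.polyLatticePoint m p q) u
  simp only [PolyLat.sq_weightedL2Discrepancy hγ]
  refine ⟨fun v _ => (hsum v).summable,
    integrable_finsetSum _ fun u _ => (key u).1.const_mul _, ?_⟩
  rw [integral_finsetSum _ fun u _ => (key u).1.const_mul _]
  simp only [integral_const_mul, (key _).2, (hsum _).tsum_eq, ← PolyLat.sum_pairMean,
    PolyLat.gammaTilde]
  simp only [Finset.sum_mul, Finset.sum_div, Finset.mul_sum]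
  -- The pairs are those with `v ⊆ u` and `v` nonempty; this already makes `u` nonempty, so for
  -- fixed `v` all supersets occur, as in `gammaTilde`.
  rw [Finset.sum_comm' (t' := Finset.univ.filter Finset.Nonempty)
    (s' := fun v => Finset.univ.filter (v ⊆ ·))]
  · exact Finset.sum_congr rfl fun v _ => Finset.sum_congr rfl fun u _ => by ring
  · intro u v
    simp only [Finset.mem_filter, Finset.mem_univ, Finset.mem_powerset, true_and]
    exact ⟨fun h => h.2, fun h => ⟨h.2.mono h.1, h⟩⟩
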